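/- Let $\mathbb H$ be the upper half plane and $q=e^{2\pi i\tau}$ for $\tau\in\mathbb H$. For a Dirichlet character $\chi$ modulo $11$ put $$E_{\chi}(\tau)=1+\frac{2}{L(0,\chi)}\sum_{n\ge1}\chi(n)\frac{q^n}{1-q^n},\qquad \mathcal E_{11}=\frac15\sum_{\chi}E_{\chi},$$ the last sum running over the odd primitive characters modulo $11$. For $a\in(\mathbb Z/11\mathbb Z)^*$ let $$\mathcal E_{a,11}(\tau)=(\gamma_{21}\tau+\gamma_{22})^{-1}\mathcal E_{11}(\gamma\tau)$$ for some $\gamma\in\Gamma_0(11)\subset SL_2(\mathbb Z)$ with lower right entry $\gamma_{22}\equiv a\pmod{11}$. Let $$\phi_k(\tau)=e^{-(2k-1)\pi i/22}\,\theta\!\left[{(2k-1)/11\atop 1}\right](0,11\tau)\quad(1\le k\le5),$$ $$\theta\!\left[{\epsilon\atop\epsilon'}\right](z,\tau)=\sum_{n\in\mathbb Z}\exp2\pi i\Big\{\tfrac12\big(n+\tfrac{\epsilon}{2}\big)^2\tau+\big(n+\tfrac{\epsilon}{2}\big)\big(z+\tfrac{\epsilon'}{2}\big)\Big\},$$ let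 $\eta$ be the Dedekind eta function, and let $$K(v,w,x,y,z)=\begin{pmatrix}w&v&0&0&z\\v&x&w&0&0\\0&w&y&x&0\\0&0&x&z&y\\z&0&0&y&v\end{pmatrix}$$ be Klein's matrix, $M_{ij}$ its minor with row $i$ and column $j$ deleted. The locus in $\mathbb{CP}^4$ where $K$ has rank $3$ is Klein's model of $X(11)$. For $p\in(\mathbb C^*)^5$ put $\kappa(p)=(v,w,x,y,z)=(p_3,p_4,p_1,-p_2,p_5)$ and $$e_1=\frac{p_2}{p_4p_5},\quad e_2=\frac{p_4}{p_1p_5},\quad e_3=\frac{p_1}{p_2p_3},\quad e_5=\frac{p_3}{p_2p_4},\quad e_7=\frac{p_5}{p_1p_3},\quad e_{-a}=-e_a .$$ For a family $(f_a)$ indexed by $(\mathbb Z/11\mathbb Z)^*$ put $$R_a(f)=f_{3a}f_{7a}+f_af_{7a}-f_{3a}f_{5a}-f_{5a}f_{7a},\qquad S_a(f)=f_af_{3a}-f_af_{5a}+f_{5a}f_{7a}.$$ Then: 1. On $\mathbb H$, $$\mathcal E_{3,11}\mathcal E_{7,11}+\mathcal E_{1,11}\mathcal E_{7,11}-\mathcal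 E_{3,11}\mathcal E_{5,11}-\mathcal E_{5,11}\mathcal E_{7,11}=0,$$ $$\mathcal E_{1,11}\mathcal E_{3,11}-\mathcal E_{1,11}\mathcal E_{5,11}+\mathcal E_{5,11}\mathcal E_{7,11}=0.$$ 2. For every $\gamma\in\Gamma_0(11)$ and every $a$, $(\gamma_{21}\tau+\gamma_{22})^{-1}\mathcal E_{11}(\gamma\tau)=\mathcal E_{\gamma_{22},11}(\tau)$ and $(\gamma_{21}\tau+\gamma_{22})^{-1}\mathcal E_{a,11}(\gamma\tau)=\mathcal E_{\gamma_{22}a,11}(\tau)$ (so $\mathcal E_{a,11}$ does not depend on the choice of $\gamma$). The images of the two relations under this action, $R_a(\mathcal E_{\cdot,11})=0$ and $S_a(\mathcal E_{\cdot,11})=0$, hold for every $a\in(\mathbb Z/11\mathbb Z)^*$. 3. The $\phi_k$ have no zeros on $\mathbb H$, and $\mathcal E_{a,11}(\tau)=\eta(11\tau)^3\,e_a$ for every $a$, where $e_a$ is formed with $p=(\phi_1(\tau),\dots,\phi_5(\tau))$. 4. For every $p\in(\mathbb C^*)^5$, with $(v,w,x,y,z)=\kappa(p)$, one has $$p_1p_2^2p_3^2p_4\,R_1(e)=M_{12}(v,w,x,y,z),$$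 $$p_1p_2p_3p_4^2p_5\,S_1(e)=-M_{13}(x,y,z,v,w),$$ $$p_1p_2p_3p_4p_5^2\,S_2(e)=-M_{13}(v,w,x,y,z),$$ and all the relations $R_a(e)=S_a(e)=0$, $a\in(\mathbb Z/11\mathbb Z)^*$, hold if and only if $K(\kappa(p))$ has rank $3$. 5. On $\mathbb H$, $$\phi_3\phi_2^3-\phi_3^2\phi_5\phi_2+\phi_1\phi_4\phi_5\phi_2-\phi_1^2\phi_3^2=0,\qquad \phi_2\phi_4\phi_1^2-\phi_1\phi_2\phi_3^2+\phi_3\phi_4\phi_5^2=0,$$ and the minors $M_{12}$ and $M_{13}$ vanish at $\kappa(\phi_1,\dots,\phi_5)=(\phi_3,\phi_4,\phi_1,-\phi_2,\phi_5)$. 6. The map $\tau\mapsto[\phi_3(\tau):\phi_4(\tau):\phi_1(\tau):-\phi_2(\tau):\phi_5(\tau)]$ is well defined on $\Gamma(11)\backslash\mathbb H$ and takes its values in the locus where $K$ has rank $3$. -/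

import Mathlib

open scoped ModularForm MatrixGroups UpperHalfPlane

noncomputable section

namespace LevelEleven

/-- The weight `k` Eisenstein series twisted by the Dirichlet character `χ`,
`1 + (2 / L(1 - k, χ)) ∑_{n ≥ 1} χ(n) n^{k-1} q^n / (1 - q^n)`, `q = e^{2πiτ}` (for `k ≥ 1`). -/
def eisSeries {p : ℕ} [NeZero p] (k : ℕ) (χ : DirichletCharacter ℂ p) (τ : ℍ) : ℂ :=
  1 + 2 / χ.LFunction (1 - (k : ℂ)) *
    ∑' n : ℕ, χ ((n + 1 : ℕ) : ZMod p) * ((n + 1 : ℕ) : ℂ) ^ (k - 1) *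
      Complex.exp (2 * Real.pi * Complex.I * τ) ^ (n + 1) /
        (1 - Complex.exp (2 * Real.pi * Complex.I * τ) ^ (n + 1))

open Classical in
/-- `𝓔_p`: the sum of the weight one series over the odd primitive characters modulo `p`,
multiplied by `2 / (p - 1)`. -/
def eisSum (p : ℕ) [NeZero p] (τ : ℍ) : ℂ :=
  2 / ((p : ℂ) - 1) *
    ∑ χ ∈ (Finset.univ : Finset (DirichletCharacter ℂ p)).filter
      (fun χ => χ.Odd ∧ χ.IsPrimitive), eisSeries 1 χ τ

open Classical in
/-- The diamond operator `⟨a⟩` in weight `k` and level `N`: the slash action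
`(c τ + d)^{-k} f (γ τ)` of a matrix `γ ∈ Γ₀(N)` whose lower right entry `d` is congruent to `a`
(zero if there is no such matrix, that is, if `a` is not a unit). -/
def diamond (N : ℕ) (k : ℤ) (a : ZMod N) (f : ℍ → ℂ) : ℍ → ℂ :=
  if h : ∃ γ : SL(2, ℤ), γ ∈ CongruenceSubgroup.Gamma0 N ∧ ((γ 1 1 : ℤ) : ZMod N) = a then
    f ∣[k] h.choose
  else 0

/-- `𝓔_{a,p} = ⟨a⟩ 𝓔_p`. -/
def eisGen (p : ℕ) [NeZero p] (a : ZMod p) : ℍ → ℂ := diamond p 1 a (eisSum p)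

/-- The theta function with characteristic `[ε, ε']`. -/
def thetaChar (ε ε' : ℝ) (z τ : ℂ) : ℂ :=
  ∑' n : ℤ, Complex.exp (2 * Real.pi * Complex.I *
    ((1 / 2) * ((n : ℂ) + ε / 2) ^ 2 * τ + ((n : ℂ) + ε / 2) * (z + ε' / 2)))

/-- The theta constant `φ_{k,l}(τ) = θ[(2l-1)/k, 1](0, kτ)` of order `k` and index `l`. -/
def thetaConst (k l : ℕ) (τ : ℍ) : ℂ :=
  thetaChar ((2 * (l : ℝ) - 1) / k) 1 0 ((k : ℂ) * τ)

/-- The normalized theta constant `exp(-(2l-1)πi/(2k)) φ_{k,l}(τ)`. -/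
def normTheta (k l : ℕ) (τ : ℍ) : ℂ :=
  Complex.exp (-((2 * (l : ℂ) - 1) * Real.pi * Complex.I / (2 * k))) * thetaConst k l τ

/-- The five normalized theta constants of order `11`; the entry `i` has index `i + 1`. -/
def thetaVec (τ : ℍ) : Fin 5 → ℂ := fun i => normTheta 11 (i + 1) τ

/-- The Laurent monomials in `p = (p₁, …, p₅)` attached to the residues `1, 2, 3, 5, 7` modulo
`11`, extended to an odd function of the residue. -/
def thetaQuot (p : Fin 5 → ℂ) (a : ZMod 11) : ℂ :=
  if a = 1 then p 1 / (p 3 * p 4) else if a = -1 then -(p 1 / (p 3 * p 4))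
  else if a = 2 then p 3 / (p 0 * p 4) else if a = -2 then -(p 3 / (p 0 * p 4))
  else if a = 3 then p 0 / (p 1 * p 2) else if a = -3 then -(p 0 / (p 1 * p 2))
  else if a = 5 then p 2 / (p 1 * p 3) else if a = -5 then -(p 2 / (p 1 * p 3))
  else if a = 7 then p 4 / (p 0 * p 2) else if a = -7 then -(p 4 / (p 0 * p 2))
  else 0

/-- The first quadratic form with all indices multiplied by `a`. -/
def relOne (e : ZMod 11 → ℂ) (a : ZMod 11) : ℂ :=
  e (3 * a) * e (7 * a) + e a * e (7 * a) - e (3 * a) * e (5 * a) - e (5 * a) * e (7 * a)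

/-- The second quadratic form with all indices multiplied by `a`. -/
def relTwo (e : ZMod 11 → ℂ) (a : ZMod 11) : ℂ :=
  e a * e (3 * a) - e a * e (5 * a) + e (5 * a) * e (7 * a)

/-- Klein's matrix at `u = (v, w, x, y, z)`. -/
def kleinMatrix (u : Fin 5 → ℂ) : Matrix (Fin 5) (Fin 5) ℂ :=
  !![u 1, u 0, 0, 0, u 4;
     u 0, u 2, u 1, 0, 0;
     0, u 1, u 3, u 2, 0;
     0, 0, u 2, u 4, u 3;
     u 4, 0, 0, u 3, u 0]

/-- The minor of Klein's matrix with row `i` and column `j` deleted (indices from `0`). -/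
def kleinMinor (i j : Fin 5) (u : Fin 5 → ℂ) : ℂ :=
  ((kleinMatrix u).submatrix i.succAbove j.succAbove).det

/-- The locus in complex projective four-space where Klein's matrix has rank three; the matrix is
linear in the point, so the rank does not depend on the representative. -/
def kleinLocus : Set (Projectivization ℂ (Fin 5 → ℂ)) :=
  {P | (kleinMatrix P.rep).rank = 3}

/-- The substitution `(v, w, x, y, z) = (p₃, p₄, p₁, -p₂, p₅)`. -/
def kleinPoint (p : Fin 5 → ℂ) : Fin 5 → ℂ := ![p 2, p 3, p 0, -p 1, p 4]

end LevelEleven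

end

/-! Everything is read off from the odd theta function `theta1` at the multiples j τ, with modulus
11 τ.

Write t_j for the value at j τ, normalized by a Gaussian factor (`thetaVal`), and Z_j for the
logarithmic derivative, corrected by a linear term (`zetaVal`). Both are odd in j. Modulo 11 the t_j
are periodic up to sign and the Z_j are periodic. For 11 not dividing j, `Γ₀(11)` multiplies j by
the upper left entry, up to explicit factors for t_j and with weight one for Z_j.

For odd χ modulo 11 the number 2/L(0,χ) equals χ(1) + χ(1/2) + χ(1/3) + χ(1/5). Orthogonality
therefore turns the average of the E_χ into a Lambert series with coefficient 1 on the residues 1,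
2, 3, 5, coefficient -1 on their negatives and 0 elsewhere. By the product formula for `theta1` this
is -(Z_1 + Z_2 + Z_3 + Z_5)/(2πi), and the diamond operators give the same sum at indices s, 2s, 3s,
5s (`eisGen_eq_eisVal`). Since s + 2s + 3s + 5s ≡ 0, a degenerate case of Weierstrass's three-term
relation evaluates the sum as a theta quotient times η(11τ)³ (`zetaVal_add`). Two theta values
cancel, leaving the monomials e_a.

In these monomials the forms R_a, S_a are, up to sign and a monomial factor, the ten off-diagonal
minors of Klein's symmetric matrix. At points with nonzero coordinates four of them already force
rank 3 (`rank_kleinMatrix_eq_three`). For the theta constants those four follow from the three-term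
relation (`rank_kleinMatrix_thetaVec`), and the Eisenstein relations are deduced from this. On
`Γ(11)` all factors in the transformation of t_j become independent of j, so the projective point is
invariant. -/

namespace LevelEleven

/-! ### The Jacobi triple product -/

open Filter Topology Finset

/-- The inverse of the finite product `(1 - Q) ⋯ (1 - Q ^ n)`, extended by zero to negative `n`. -/
noncomputable def qPochInv (Q : ℂ) (n : ℤ) : ℂ :=
  if n < 0 then 0 else (∏ i ∈ range n.toNat, (1 - Q ^ (i + 1)))⁻¹

lemma one_sub_pow_succ_ne_zero {Q : ℂ} (hQ : ‖Q‖ < 1) (n : ℕ) : 1 - Q ^ (n + 1) ≠ 0 := by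
  intro h
  have : ‖Q ^ (n + 1)‖ < 1 := by
    rw [norm_pow]; exact pow_lt_one₀ (norm_nonneg _) hQ (by omega)
  rw [← sub_eq_zero.mp h] at this
  simp at this

/-- The extension by zero makes this hold for every integer, since at n = 0 the factor 1 - Q ^ 0
vanishes. Boundary terms of the finite sum thus need no separate treatment. -/
lemma qPochInv_sub_one {Q : ℂ} (hQ : ‖Q‖ < 1) (n : ℤ) :
    qPochInv Q (n - 1) = (1 - Q ^ n) * qPochInv Q n := by
  rcases lt_trichotomy n 0 with h | rfl | h
  · simp [qPochInv, h, show n - 1 < 0 by omega]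
  · simp [qPochInv]
  · obtain ⟨m, rfl⟩ : ∃ m : ℕ, n = m + 1 := ⟨(n - 1).toNat, by omega⟩
    have h1 : ((m : ℤ) + 1).toNat = m + 1 := by omega
    have h3 : ¬ ((m : ℤ) + 1 < 0) := by omega
    have h2 := one_sub_pow_succ_ne_zero hQ m
    have h4 : Q ^ ((m : ℤ) + 1) = Q ^ (m + 1) := by norm_cast
    simp only [qPochInv, add_sub_cancel_right, Int.toNat_natCast, h1, prod_range_succ, h3, h4,
      mul_inv, if_false, show ¬ ((m : ℤ) < 0) by omega]
    field_simp

/-- The finite form of the Jacobi triple product identity. -/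
theorem hasSum_finite_tripleProduct {q x : ℂ} (hq0 : q ≠ 0) (hx : x ≠ 0) (hq : ‖q‖ < 1) (N : ℕ) :
    HasSum (fun k : ℤ ↦ q ^ (k ^ 2) * (∏ i ∈ range (2 * N), (1 - (q ^ 2) ^ (i + 1))) *
        qPochInv (q ^ 2) (N - k) * qPochInv (q ^ 2) (N + k) * x ^ k)
      (∏ n ∈ range N, (1 + x * q ^ (2 * n + 1)) * (1 + x⁻¹ * q ^ (2 * n + 1))) := by
  have hQ : ‖q ^ 2‖ < 1 := by
    rw [norm_pow]; exact pow_lt_one₀ (norm_nonneg _) hq (by omega)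
  induction N with
  | zero =>
    have := hasSum_single (f := fun k : ℤ ↦ q ^ (k ^ 2) *
        (∏ i ∈ range (2 * 0), (1 - (q ^ 2) ^ (i + 1))) *
        qPochInv (q ^ 2) ((0 : ℕ) - k) * qPochInv (q ^ 2) ((0 : ℕ) + k) * x ^ k) 0 (by
      intro k hk
      rcases lt_or_gt_of_ne hk with h | h
      · simp [qPochInv, h]
      · simp [qPochInv, h])
    simpa [qPochInv] using this
  | succ N ih =>
    -- With y = q ^ (2N+1), the new factor (1 + x y)(1 + y/x) is (1 + y²) + x y + y/x. The last two
    -- summands shift the summation index, so the claim becomes a termwise recursion for Gaussian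
    -- binomials.
    have h0 := ih.mul_right (1 + (q ^ (2 * N + 1)) ^ 2)
    have h1 := (((Equiv.subRight (1 : ℤ)).hasSum_iff).mpr ih).mul_right (x * q ^ (2 * N + 1))
    have h2 := (((Equiv.addRight (1 : ℤ)).hasSum_iff).mpr ih).mul_right (x⁻¹ * q ^ (2 * N + 1))
    convert! (h0.add h1).add h2 using 1
    · funext k
      simp only [Function.comp_apply, Equiv.subRight_apply, Equiv.coe_addRight]
      -- Everything is expressed through t, q ^ (2N) and the two inverse products of level N + 1;
      -- the recursion is then a rational identity.
      set t := q ^ k with ht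
      have ht0 : t ≠ 0 := zpow_ne_zero _ hq0
      have e1 : q ^ ((k - 1) ^ 2) = q ^ (k ^ 2) * q / t ^ 2 := by
        rw [show (k - 1) ^ 2 = k ^ 2 + 1 - (k + k) by ring, zpow_sub₀ hq0, zpow_add₀ hq0,
          zpow_add₀ hq0, zpow_one]; ring
      have e2 : q ^ ((k + 1) ^ 2) = q ^ (k ^ 2) * q * t ^ 2 := by
        rw [show (k + 1) ^ 2 = k ^ 2 + 1 + (k + k) by ring, zpow_add₀ hq0, zpow_add₀ hq0,
          zpow_add₀ hq0, zpow_one]; ring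
      have x1 : x ^ (k - 1) = x ^ k / x := by rw [zpow_sub₀ hx, zpow_one]
      have x2 : x ^ (k + 1) = x ^ k * x := by rw [zpow_add₀ hx, zpow_one]
      have zz : ∀ m : ℤ, (q ^ 2) ^ m = q ^ m * q ^ m := fun m ↦ by
        rw [pow_two, mul_zpow]
      have qq : ∀ m : ℕ, q ^ (m : ℤ) = q ^ m := fun m ↦ zpow_natCast _ _
      have A1 : (q ^ 2) ^ (((N + 1 : ℕ) : ℤ) - k) = q ^ (2 * N + 2) / t ^ 2 := by
        rw [zz, zpow_sub₀ hq0, qq]; field_simp; ring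
      have B1 : (q ^ 2) ^ (((N + 1 : ℕ) : ℤ) + k) = q ^ (2 * N + 2) * t ^ 2 := by
        rw [zz, zpow_add₀ hq0, qq]; ring
      have A2 : (q ^ 2) ^ ((N : ℤ) - k) = q ^ (2 * N) / t ^ 2 := by
        rw [zz, zpow_sub₀ hq0, qq]; field_simp; ring
      have B2 : (q ^ 2) ^ ((N : ℤ) + k) = q ^ (2 * N) * t ^ 2 := by
        rw [zz, zpow_add₀ hq0, qq]; ring
      have u1 := qPochInv_sub_one hQ (((N + 1 : ℕ) : ℤ) - k)
      have w1 := qPochInv_sub_one hQ (((N + 1 : ℕ) : ℤ) + k)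
      have u2 := qPochInv_sub_one hQ ((N : ℤ) - k)
      have w2 := qPochInv_sub_one hQ ((N : ℤ) + k)
      rw [A1, show (((N + 1 : ℕ) : ℤ) - k - 1) = (N : ℤ) - k by push_cast; ring] at u1
      rw [B1, show (((N + 1 : ℕ) : ℤ) + k - 1) = (N : ℤ) + k by push_cast; ring] at w1
      rw [A2, u1] at u2
      rw [B2, w1] at w2
      rw [show (N : ℤ) - (k - 1) = ((N + 1 : ℕ) : ℤ) - k by push_cast; ring,
        show (N : ℤ) + (k - 1) = (N : ℤ) + k - 1 by ring,
        show (N : ℤ) - (k + 1) = (N : ℤ) - k - 1 by ring,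
        show (N : ℤ) + (k + 1) = ((N + 1 : ℕ) : ℤ) + k by push_cast; ring,
        u2, w2, u1, w1, e1, e2, x1, x2, show 2 * (N + 1) = 2 * N + 1 + 1 by ring,
        prod_range_succ, prod_range_succ]
      generalize qPochInv (q ^ 2) (((N + 1 : ℕ) : ℤ) - k) = u
      generalize qPochInv (q ^ 2) (((N + 1 : ℕ) : ℤ) + k) = w
      generalize (∏ i ∈ range (2 * N), (1 - (q ^ 2) ^ (i + 1))) = P
      generalize q ^ (k ^ 2) = R
      generalize x ^ k = X
      have p1 : (q ^ 2) ^ (2 * N + 1) = q ^ 2 * (q ^ (2 * N)) ^ 2 := by ring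
      have p2 : (q ^ 2) ^ (2 * N + 1 + 1) = q ^ 4 * (q ^ (2 * N)) ^ 2 := by ring
      rw [p1, p2, pow_succ q (2 * N), pow_add q (2 * N) 2]
      generalize q ^ (2 * N) = y
      field_simp
      ring
    · rw [prod_range_succ]
      field_simp
      ring


lemma summable_norm_mul_pow_two_mul_add_one {q : ℂ} (hq : ‖q‖ < 1) (x : ℂ) :
    Summable fun n : ℕ ↦ ‖x * q ^ (2 * n + 1)‖ := by
  have h : Summable fun n : ℕ ↦ ‖x * q‖ * (‖q‖ ^ 2) ^ n :=
    (summable_geometric_of_lt_one (by positivity)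
      (pow_lt_one₀ (norm_nonneg _) hq (by omega))).mul_left _
  refine h.congr fun n ↦ ?_
  rw [norm_mul, norm_mul, norm_pow]; ring

/-- The Jacobi triple product identity. -/
theorem jacobiTheta₂_eq_tprod (z : ℂ) {τ : ℂ} (hτ : 0 < τ.im) {q x : ℂ}
    (hq : q = Complex.exp (Real.pi * Complex.I * τ))
    (hx : x = Complex.exp (2 * Real.pi * Complex.I * z)) :
    jacobiTheta₂ z τ = (∏' n : ℕ, (1 - (q ^ 2) ^ (n + 1))) *
      ((∏' n : ℕ, (1 + x * q ^ (2 * n + 1))) * ∏' n : ℕ, (1 + x⁻¹ * q ^ (2 * n + 1))) := by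
  have hq0 : q ≠ 0 := hq ▸ Complex.exp_ne_zero _
  have hx0 : x ≠ 0 := hx ▸ Complex.exp_ne_zero _
  have hq1 : ‖q‖ < 1 := by
    rw [hq, Complex.norm_exp]
    simp only [Complex.mul_re, Complex.mul_im, Complex.ofReal_re, Complex.ofReal_im, Complex.I_re,
      Complex.I_im]
    rw [Real.exp_lt_one_iff]
    nlinarith [Real.pi_pos, mul_pos Real.pi_pos hτ]
  have hQ : ‖q ^ 2‖ < 1 := by
    rw [norm_pow]; exact pow_lt_one₀ (norm_nonneg _) hq1 (by omega)
  have hterm : ∀ k : ℤ, jacobiTheta₂_term k z τ = q ^ (k ^ 2) * x ^ k := by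
    intro k
    rw [jacobiTheta₂_term, hq, hx, ← Complex.exp_int_mul, ← Complex.exp_int_mul, ← Complex.exp_add]
    congr 1; push_cast; ring
  set p : ℕ → ℂ := fun N ↦ ∏ i ∈ range N, (1 - (q ^ 2) ^ (i + 1)) with hp
  set p' : ℂ := ∏' n : ℕ, (1 - (q ^ 2) ^ (n + 1)) with hp'
  have hsumQ : Summable fun n : ℕ ↦ ‖-(q ^ 2) ^ (n + 1)‖ := by
    simpa using (summable_nat_add_iff 1).mpr (summable_geometric_of_lt_one (norm_nonneg _) hQ)
  have hpt : Tendsto p atTop (𝓝 p') :=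
    (ModularForm.multipliable_one_sub_pow hQ).hasProd.tendsto_prod_nat
  have hp0 : p' ≠ 0 := by
    refine tprod_one_add_ne_zero_of_summable (f := fun n : ℕ ↦ -(q ^ 2) ^ (n + 1)) ?_ hsumQ
    intro n
    simpa [sub_eq_add_neg] using one_sub_pow_succ_ne_zero hQ n
  have hpit : Tendsto (fun n ↦ (p n)⁻¹) atTop (𝓝 p'⁻¹) := hpt.inv₀ hp0
  obtain ⟨C₁, hC₁⟩ := hpt.norm.bddAbove_range
  obtain ⟨C₂, hC₂⟩ := hpit.norm.bddAbove_range
  have hC₁' : ∀ n, ‖p n‖ ≤ C₁ := fun n ↦ hC₁ ⟨n, rfl⟩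
  have hC₂' : ∀ n, ‖(p n)⁻¹‖ ≤ C₂ := fun n ↦ hC₂ ⟨n, rfl⟩
  have hC₁0 : 0 ≤ C₁ := (norm_nonneg _).trans (hC₁' 0)
  have hC₂0 : 0 ≤ C₂ := (norm_nonneg _).trans (hC₂' 0)
  have hinv : ∀ n : ℤ, ‖qPochInv (q ^ 2) n‖ ≤ C₂ := by
    intro n
    rw [qPochInv]
    split_ifs with h
    · simpa using hC₂0
    · exact hC₂' _
  have hsum : Summable fun k : ℤ ↦ ‖q ^ (k ^ 2) * x ^ k‖ := by
    have := ((summable_jacobiTheta₂_term_iff z τ).mpr hτ).norm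
    simpa only [hterm] using this
  -- Dominated convergence: the products and their inverses are bounded uniformly in N, and the
  -- Gaussian series converges absolutely.
  have hlim : Tendsto (fun N : ℕ ↦ ∑' k : ℤ, q ^ (k ^ 2) * p (2 * N) *
      qPochInv (q ^ 2) (N - k) * qPochInv (q ^ 2) (N + k) * x ^ k) atTop
      (𝓝 (∑' k : ℤ, q ^ (k ^ 2) * p' * p'⁻¹ * p'⁻¹ * x ^ k)) := by
    refine tendsto_tsum_of_dominated_convergence
      (bound := fun k : ℤ ↦ (C₁ * C₂ * C₂) * ‖q ^ (k ^ 2) * x ^ k‖) (hsum.mul_left _) ?_ ?_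
    · intro k
      have ht1 : Tendsto (fun N : ℕ ↦ qPochInv (q ^ 2) ((N : ℤ) - k)) atTop (𝓝 p'⁻¹) := by
        have h := hpit.comp (tendsto_atTop.mpr fun b : ℕ ↦
          (eventually_ge_atTop (b + k.natAbs)).mono fun N hN ↦
            (show b ≤ ((N : ℤ) - k).toNat by omega))
        refine h.congr' ((eventually_ge_atTop k.natAbs).mono fun N hN ↦ ?_)
        simp only [qPochInv, if_neg (show ¬ ((N : ℤ) - k < 0) by omega)]; rfl
      have ht2 : Tendsto (fun N : ℕ ↦ qPochInv (q ^ 2) ((N : ℤ) + k)) atTop (𝓝 p'⁻¹) := by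
        have h := hpit.comp (tendsto_atTop.mpr fun b : ℕ ↦
          (eventually_ge_atTop (b + k.natAbs)).mono fun N hN ↦
            (show b ≤ ((N : ℤ) + k).toNat by omega))
        refine h.congr' ((eventually_ge_atTop k.natAbs).mono fun N hN ↦ ?_)
        simp only [qPochInv, if_neg (show ¬ ((N : ℤ) + k < 0) by omega)]; rfl
      have ht0 : Tendsto (fun N : ℕ ↦ p (2 * N)) atTop (𝓝 p') :=
        hpt.comp (tendsto_atTop.mpr fun b : ℕ ↦
          (eventually_ge_atTop b).mono fun N hN ↦ (show b ≤ 2 * N by omega))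
      exact (((tendsto_const_nhds.mul ht0).mul ht1).mul ht2).mul tendsto_const_nhds
    · refine Eventually.of_forall fun N k ↦ ?_
      have h1 := hC₁' (2 * N)
      have h2 := hinv (N - k)
      have h3 := hinv (N + k)
      calc _ = (‖p (2 * N)‖ * ‖qPochInv (q ^ 2) (N - k)‖ * ‖qPochInv (q ^ 2) (N + k)‖) *
            ‖q ^ (k ^ 2) * x ^ k‖ := by simp only [norm_mul]; ring
        _ ≤ _ := by gcongr
  have hfin : Tendsto (fun N : ℕ ↦
      ∏ n ∈ range N, (1 + x * q ^ (2 * n + 1)) * (1 + x⁻¹ * q ^ (2 * n + 1))) atTop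
      (𝓝 ((∏' n : ℕ, (1 + x * q ^ (2 * n + 1))) * ∏' n : ℕ, (1 + x⁻¹ * q ^ (2 * n + 1)))) := by
    simp only [prod_mul_distrib]
    exact (multipliable_one_add_of_summable
      (summable_norm_mul_pow_two_mul_add_one hq1 x)).hasProd.tendsto_prod_nat.mul
      (multipliable_one_add_of_summable
        (summable_norm_mul_pow_two_mul_add_one hq1 x⁻¹)).hasProd.tendsto_prod_nat
  have heq := tendsto_nhds_unique (hlim.congr fun N ↦
    (hasSum_finite_tripleProduct hq0 hx0 hq1 N).tsum_eq) hfin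
  rw [← heq, jacobiTheta₂, ← tsum_mul_left]
  refine tsum_congr fun k ↦ ?_
  rw [hterm]; field_simp

end LevelEleven

/-! ### The odd theta function -/

namespace LevelEleven

open Complex

/-- The odd Jacobi theta function. -/
noncomputable def theta1 (z τ : ℂ) : ℂ := thetaChar 1 1 z τ

/-- Completing the square absorbs the characteristic, so the known properties of `jacobiTheta₂`
carry over. -/
lemma theta1_eq (z τ : ℂ) : theta1 z τ =
    exp (Real.pi * I * (τ / 4 + z + 1 / 2)) * jacobiTheta₂ (z + 1 / 2 + τ / 2) τ := by
  rw [theta1, thetaChar, jacobiTheta₂, ← tsum_mul_left]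
  refine tsum_congr fun n ↦ ?_
  rw [jacobiTheta₂_term, ← exp_add]
  congr 1; push_cast; ring

lemma neg_cexp (w : ℂ) : -exp w = exp (w + Real.pi * I) := by
  rw [exp_add, exp_pi_mul_I]; ring

lemma theta1_neg (z τ : ℂ) : theta1 (-z) τ = -theta1 z τ := by
  rw [theta1_eq, theta1_eq, ← jacobiTheta₂_neg_left,
    show z + 1 / 2 + τ / 2 = (-(-z + 1 / 2 + τ / 2) + 1) + τ by ring, jacobiTheta₂_add_left',
    jacobiTheta₂_add_left, ← mul_assoc, ← exp_add, ← neg_mul]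
  congr 1
  rw [neg_cexp, exp_eq_exp_iff_exists_int]
  exact ⟨0, by push_cast; ring⟩

@[simp] lemma theta1_zero (τ : ℂ) : theta1 0 τ = 0 := by
  have h := theta1_neg 0 τ
  rw [neg_zero] at h
  exact self_eq_neg.mp h

lemma theta1_add_one (z τ : ℂ) : theta1 (z + 1) τ = -theta1 z τ := by
  rw [theta1_eq, theta1_eq, show z + 1 + 1 / 2 + τ / 2 = z + 1 / 2 + τ / 2 + 1 by ring,
    jacobiTheta₂_add_left, ← neg_mul]
  congr 1
  rw [neg_cexp]
  congr 1; ring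

lemma theta1_add_tau (z τ : ℂ) :
    theta1 (z + τ) τ = -exp (-Real.pi * I * (τ + 2 * z)) * theta1 z τ := by
  rw [theta1_eq, theta1_eq, show z + τ + 1 / 2 + τ / 2 = z + 1 / 2 + τ / 2 + τ by ring,
    jacobiTheta₂_add_left', ← mul_assoc, ← mul_assoc]
  congr 1
  rw [neg_cexp, ← exp_add, ← exp_add, exp_eq_exp_iff_exists_int]
  exact ⟨-1, by push_cast; ring⟩

lemma differentiable_theta1 {τ : ℂ} (hτ : 0 < τ.im) : Differentiable ℂ (theta1 · τ) := by
  have : (theta1 · τ) = fun z ↦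
      exp (Real.pi * I * (τ / 4 + z + 1 / 2)) * jacobiTheta₂ (z + 1 / 2 + τ / 2) τ := by
    funext z; exact theta1_eq z τ
  rw [this]
  intro z
  refine DifferentiableAt.mul (by fun_prop) ?_
  exact (differentiableAt_jacobiTheta₂_fst (z + 1 / 2 + τ / 2) hτ).comp z
    (f := fun z ↦ z + 1 / 2 + τ / 2) (by fun_prop)

/-! ### Addition formula and Weierstrass relations -/

section Addition

/-- Summation over pairs of integers by the parity of their sum. -/
lemma hasSum_int_prod_of_parity {F : ℤ × ℤ → ℂ} {a b : ℂ}
    (ha : HasSum (fun p : ℤ × ℤ ↦ F (p.1 + p.2, p.1 - p.2 - 1)) a)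
    (hb : HasSum (fun p : ℤ × ℤ ↦ F (p.1 + p.2, p.1 - p.2)) b) : HasSum F (a + b) := by
  set i₁ : ℤ × ℤ → ℤ × ℤ := fun p ↦ (p.1 + p.2, p.1 - p.2 - 1)
  set i₂ : ℤ × ℤ → ℤ × ℤ := fun p ↦ (p.1 + p.2, p.1 - p.2)
  have h₁ : Function.Injective i₁ := by
    rintro ⟨k, l⟩ ⟨k', l'⟩ h
    simp only [i₁, Prod.mk.injEq] at h ⊢
    omega
  have h₂ : Function.Injective i₂ := by
    rintro ⟨k, l⟩ ⟨k', l'⟩ h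
    simp only [i₂, Prod.mk.injEq] at h ⊢
    omega
  have hc : IsCompl (Set.range i₁) (Set.range i₂) := by
    constructor
    · rw [Set.disjoint_left]
      rintro _ ⟨⟨k, l⟩, rfl⟩ ⟨⟨k', l'⟩, h⟩
      simp only [i₁, i₂, Prod.mk.injEq] at h
      omega
    · rw [codisjoint_iff_le_sup]
      rintro ⟨m, n⟩ -
      rcases Int.even_or_odd' (m + n) with ⟨k, hk | hk⟩
      · exact Or.inr ⟨(k, m - k), by simp only [i₂, Prod.mk.injEq]; omega⟩
      · exact Or.inl ⟨(k + 1, m - k - 1), by simp only [i₁, Prod.mk.injEq]; omega⟩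
  exact HasSum.add_isCompl hc (h₁.hasSum_range_iff.mpr ha) (h₂.hasSum_range_iff.mpr hb)

lemma summable_norm_jacobiTheta₂_term (z : ℂ) {τ : ℂ} (hτ : 0 < τ.im) :
    Summable fun n ↦ ‖jacobiTheta₂_term n z τ‖ :=
  ((summable_jacobiTheta₂_term_iff z τ).mpr hτ).norm

/-- The addition formula expressing `θ(a + b) θ(a - b)` through theta functions of `2τ`. -/
theorem theta1_add_mul_theta1_sub (a b : ℂ) {τ : ℂ} (hτ : 0 < τ.im) :
    theta1 (a + b) τ * theta1 (a - b) τ =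
      jacobiTheta₂ (2 * a) (2 * τ) *
        (exp (Real.pi * I * (τ / 2 + 2 * b)) * jacobiTheta₂ (2 * b + τ) (2 * τ)) -
      (exp (Real.pi * I * (τ / 2 + 2 * a)) * jacobiTheta₂ (2 * a + τ) (2 * τ)) *
        jacobiTheta₂ (2 * b) (2 * τ) := by
  have hτ2 : 0 < (2 * τ).im := by simpa using hτ
  have hmul : ∀ (c z w σ σ' : ℂ) (_ : 0 < σ.im) (_ : 0 < σ'.im),
      HasSum (fun p : ℤ × ℤ ↦ c * (jacobiTheta₂_term p.1 z σ * jacobiTheta₂_term p.2 w σ'))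
        (c * (jacobiTheta₂ z σ * jacobiTheta₂ w σ')) := by
    intro c z w σ σ' h h'
    refine HasSum.mul_left _ ?_
    rw [jacobiTheta₂, jacobiTheta₂, tsum_mul_tsum_of_summable_norm
      (summable_norm_jacobiTheta₂_term z h) (summable_norm_jacobiTheta₂_term w h')]
    exact (summable_mul_of_summable_norm (summable_norm_jacobiTheta₂_term z h)
      (summable_norm_jacobiTheta₂_term w h')).hasSum
  have hL := hmul (exp (Real.pi * I * (τ / 4 + (a + b) + 1 / 2)) *
    exp (Real.pi * I * (τ / 4 + (a - b) + 1 / 2))) (a + b + 1 / 2 + τ / 2) (a - b + 1 / 2 + τ / 2)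
    τ τ hτ hτ
  have hA := hmul (exp (Real.pi * I * (τ / 2 + 2 * b))) (2 * a) (2 * b + τ) _ _ hτ2 hτ2
  have hB := hmul (-exp (Real.pi * I * (τ / 2 + 2 * a))) (2 * a + τ) (2 * b) _ _ hτ2 hτ2
  -- The substitution diagonalizes (m + 1/2)² + (n + 1/2)², which doubles the modulus. The sign of a
  -- term is that of (-1) ^ (m + n + 1): plus on the odd class, minus on the even class.
  have h := hL.unique (hasSum_int_prod_of_parity (a := exp (Real.pi * I * (τ / 2 + 2 * b)) *
      (jacobiTheta₂ (2 * a) (2 * τ) * jacobiTheta₂ (2 * b + τ) (2 * τ)))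
    (b := -exp (Real.pi * I * (τ / 2 + 2 * a)) *
      (jacobiTheta₂ (2 * a + τ) (2 * τ) * jacobiTheta₂ (2 * b) (2 * τ))) ?_ ?_)
  · rw [theta1_eq, theta1_eq]
    linear_combination h
  · convert! hA using 2 with p
    simp only [jacobiTheta₂_term, ← exp_add]
    rw [exp_eq_exp_iff_exists_int]
    exact ⟨p.1, by push_cast; ring⟩
  · convert! hB using 2 with p
    simp only [jacobiTheta₂_term, ← exp_add, neg_cexp]
    rw [exp_eq_exp_iff_exists_int]
    exact ⟨p.1, by push_cast; ring⟩

/-- The three-term relation of Weierstrass. -/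
theorem theta1_three_term (a b c d : ℂ) {τ : ℂ} (hτ : 0 < τ.im) :
    theta1 (a + b) τ * theta1 (a - b) τ * (theta1 (c + d) τ * theta1 (c - d) τ) -
      theta1 (a + c) τ * theta1 (a - c) τ * (theta1 (b + d) τ * theta1 (b - d) τ) +
      theta1 (a + d) τ * theta1 (a - d) τ * (theta1 (b + c) τ * theta1 (b - c) τ) = 0 := by
  -- Each product θ(a + b) θ(a - b) is a 2 × 2 determinant A(a) B(b) - B(a) A(b), so the claim is
  -- the Plücker relation.
  simp only [theta1_add_mul_theta1_sub _ _ hτ]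
  ring

/-- The limiting case of the three-term relation as two arguments coincide. -/
theorem theta1_four_term (a b c : ℂ) {τ : ℂ} (hτ : 0 < τ.im) :
    theta1 (a + b) τ * theta1 (a - b) τ * (theta1 (2 * c) τ * deriv (theta1 · τ) 0) =
      theta1 (b + c) τ * theta1 (b - c) τ *
        (deriv (theta1 · τ) (a + c) * theta1 (a - c) τ -
          theta1 (a + c) τ * deriv (theta1 · τ) (a - c)) -
      theta1 (a + c) τ * theta1 (a - c) τ *
        (deriv (theta1 · τ) (b + c) * theta1 (b - c) τ -
          theta1 (b + c) τ * deriv (theta1 · τ) (b - c)) := by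
  have hd : ∀ w, HasDerivAt (theta1 · τ) (deriv (theta1 · τ) w) w :=
    fun w ↦ (differentiable_theta1 hτ w).hasDerivAt
  have hp : ∀ w, HasDerivAt (fun d ↦ theta1 (w + d) τ) (deriv (theta1 · τ) (w + c)) c :=
    fun w ↦ (hd (w + c)).comp_const_add w c
  have hm : ∀ w, HasDerivAt (fun d ↦ theta1 (w - d) τ) (-deriv (theta1 · τ) (w - c)) c :=
    fun w ↦ (hd (w - c)).comp_const_sub w c
  -- The three-term relation is differentiated in d at d = c; as θ(0) = 0, only -θ(2c) θ'(0)
  -- survives from θ(c + d) θ(c - d).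
  have h := ((((hp c).mul (hm c)).const_mul (theta1 (a + b) τ * theta1 (a - b) τ)).sub
    (((hp b).mul (hm b)).const_mul (theta1 (a + c) τ * theta1 (a - c) τ))).add
    (((hp a).mul (hm a)).mul_const (theta1 (b + c) τ * theta1 (b - c) τ))
  have h0 := h.unique ((hasDerivAt_const c (0 : ℂ)).congr_of_eventuallyEq
    (Filter.Eventually.of_forall fun d ↦ by simpa using! theta1_three_term a b c d hτ))
  simp only [sub_self, theta1_zero, ← two_mul] at h0
  linear_combination -h0

end Addition

/-! ### Modular transformation of the odd theta function -/

section Transformation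

open UpperHalfPlane hiding I
open ModularGroup Matrix.SpecialLinearGroup

lemma theta1_tau_add_one (z τ : ℂ) :
    theta1 z (τ + 1) = exp (Real.pi * I / 4) * theta1 z τ := by
  rw [theta1, theta1, thetaChar, thetaChar, ← tsum_mul_left]
  refine tsum_congr fun n ↦ ?_
  rw [← exp_add, exp_eq_exp_iff_exists_int]
  obtain ⟨k, hk⟩ := Int.even_mul_succ_self n
  have hk' : (n : ℂ) * (n + 1) = k + k := by exact_mod_cast hk
  exact ⟨k, by push_cast; linear_combination Real.pi * I * hk'⟩

/-- The constant only has to be nonzero and independent of z: it drops out of logarithmic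
derivatives and of projective points. -/
lemma theta1_inversion {τ : ℂ} (hτ : τ ≠ 0) : ∃ C : ℂ, C ≠ 0 ∧ ∀ z,
    theta1 (z / τ) (-1 / τ) = C * exp (Real.pi * I * z ^ 2 / τ) * theta1 z τ := by
  have h1 : (-I * τ) ^ (1 / 2 : ℂ) ≠ 0 := by
    simp [hτ, cpow_eq_zero_iff]
  refine ⟨exp (-Real.pi * I / 2) * (-I * τ) ^ (1 / 2 : ℂ), mul_ne_zero (exp_ne_zero _) h1,
    fun z ↦ ?_⟩
  rw [theta1_eq, theta1_eq, jacobiTheta₂_functional_equation _ τ,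
    show z / τ + 1 / 2 + -1 / τ / 2 = (z + 1 / 2 + τ / 2) / τ + -1 / τ by field_simp; ring,
    jacobiTheta₂_add_left']
  generalize jacobiTheta₂ ((z + 1 / 2 + τ / 2) / τ) (-1 / τ) = J
  calc _ = exp (Real.pi * I * (-1 / τ / 4 + z / τ + 1 / 2) +
        -Real.pi * I * (-1 / τ + 2 * ((z + 1 / 2 + τ / 2) / τ))) * J := by rw [exp_add]; ring
    _ = exp (-Real.pi * I / 2 + Real.pi * I * z ^ 2 / τ + Real.pi * I * (τ / 4 + z + 1 / 2) +
        -Real.pi * I * (z + 1 / 2 + τ / 2) ^ 2 / τ) * J := by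
      congr 2
      field_simp
      ring
    _ = _ := by
      rw [exp_add, exp_add, exp_add]
      field_simp

lemma denom_mul_SL (g₁ g₂ : SL(2, ℤ)) (τ : ℍ) :
    denom ↑(g₁ * g₂) τ = denom g₁ (g₂ • τ : ℍ) * denom g₂ τ := by
  have hn₂ : denom g₂ τ ≠ 0 := denom_ne_zero _ _
  rw [ModularGroup.denom_apply, ModularGroup.denom_apply, coe_specialLinearGroup_apply]
  rw [ModularGroup.denom_apply] at hn₂ ⊢
  simp only [Matrix.SpecialLinearGroup.coe_mul, Matrix.mul_apply, Fin.sum_univ_two,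
    algebraMap_int_eq, eq_intCast, ofReal_intCast] at hn₂ ⊢
  push_cast
  field_simp
  ring

/-- The transformation law of the odd theta function under the modular group. -/
theorem theta1_smul (γ : SL(2, ℤ)) (τ : ℍ) : ∃ C : ℂ, C ≠ 0 ∧ ∀ z,
    theta1 (z / denom γ τ) ((γ • τ : ℍ) : ℂ) =
      C * exp (Real.pi * I * (γ 1 0 : ℤ) * z ^ 2 / denom γ τ) * theta1 z τ := by
  have hγ : γ ∈ Subgroup.closure {S, T} := by simp [SpecialLinearGroup.SL2Z_generators]
  induction hγ using Subgroup.closure_induction generalizing τ with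
  | mem g hg =>
    rcases hg with rfl | rfl
    · obtain ⟨C, hC, h⟩ := theta1_inversion (UpperHalfPlane.ne_zero τ)
      refine ⟨C, hC, fun z ↦ ?_⟩
      have h1 : ((S • τ : ℍ) : ℂ) = -1 / (τ : ℂ) := by
        rw [modular_S_smul]; simp [neg_div, inv_neg]
      have h2 : denom (S : SL(2, ℤ)) τ = τ := denom_S τ
      rw [h1, h2, h]
      simp [S]
    · refine ⟨exp (Real.pi * I / 4), exp_ne_zero _, fun z ↦ ?_⟩
      have h1 : ((T • τ : ℍ) : ℂ) = τ + 1 := by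
        rw [modular_T_smul]; simp [add_comm]
      have h2 : denom (T : SL(2, ℤ)) τ = 1 := by
        rw [ModularGroup.denom_apply]; simp [T]
      rw [h1, h2, div_one, theta1_tau_add_one]
      simp [T]
  | one => exact ⟨1, one_ne_zero, fun z ↦ by simp [denom]⟩
  | mul g₁ g₂ _ _ ih₁ ih₂ =>
    obtain ⟨C₁, hC₁, h₁⟩ := ih₁ (g₂ • τ)
    obtain ⟨C₂, hC₂, h₂⟩ := ih₂ τ
    refine ⟨C₁ * C₂, mul_ne_zero hC₁ hC₂, fun z ↦ ?_⟩
    have hd : denom ↑(g₁ * g₂) τ = denom g₁ (g₂ • τ : ℍ) * denom g₂ τ := denom_mul_SL g₁ g₂ τ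
    have hn₁ : denom g₁ (g₂ • τ : ℍ) ≠ 0 := denom_ne_zero _ _
    have hn₂ : denom g₂ τ ≠ 0 := denom_ne_zero _ _
    -- This cocycle identity for lower left entries is what makes the two Gaussian exponents add up.
    have hc : (((g₁ * g₂) 1 0 : ℤ) : ℂ) * denom g₂ τ =
        (g₁ 1 0 : ℤ) + (g₂ 1 0 : ℤ) * (denom g₁ (g₂ • τ : ℍ) * denom g₂ τ) := by
      have hdet : ((g₂ 0 0 : ℤ) : ℂ) * (g₂ 1 1 : ℤ) - (g₂ 0 1 : ℤ) * (g₂ 1 0 : ℤ) = 1 := by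
        have := Matrix.det_fin_two (g₂ : Matrix (Fin 2) (Fin 2) ℤ)
        rw [g₂.det_coe] at this
        exact_mod_cast this.symm
      rw [← hd]
      simp only [ModularGroup.denom_apply, Matrix.SpecialLinearGroup.coe_mul, Matrix.mul_apply,
        Fin.sum_univ_two]
      push_cast
      linear_combination ((g₁ 1 0 : ℤ) : ℂ) * hdet
    rw [hd, mul_smul, mul_comm (denom g₁ _), ← div_div, h₁, h₂, mul_mul_mul_comm C₁, ← mul_assoc]
    rw [← mul_assoc, mul_assoc (C₁ * C₂), ← exp_add]
    congr 3
    field_simp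
    linear_combination -z ^ 2 * hc
  | inv g _ ih =>
    obtain ⟨C, hC, h⟩ := ih (g⁻¹ • τ)
    refine ⟨C⁻¹, inv_ne_zero hC, fun z ↦ ?_⟩
    have hd : 1 = denom g (g⁻¹ • τ : ℍ) * denom ↑(g⁻¹) τ := by
      rw [← denom_mul_SL, mul_inv_cancel]; simp [denom]
    have hn₁ : denom g (g⁻¹ • τ : ℍ) ≠ 0 := denom_ne_zero _ _
    have hn₂ : denom ↑(g⁻¹) τ ≠ 0 := denom_ne_zero _ _
    have hc : (((g⁻¹) 1 0 : ℤ) : ℂ) = -(g 1 0 : ℤ) := by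
      simp [Matrix.SpecialLinearGroup.SL2_inv_expl]
    have := h (z / denom ↑(g⁻¹) τ)
    rw [smul_inv_smul, div_div, mul_comm (denom ↑(g⁻¹) τ), ← hd, div_one] at this
    rw [this, hc, ← mul_assoc, mul_mul_mul_comm, inv_mul_cancel₀ hC, ← exp_add]
    have h2 : denom ↑(g⁻¹) τ = (denom g (g⁻¹ • τ : ℍ))⁻¹ := by
      field_simp; rw [mul_comm]; exact hd.symm
    rw [h2]
    field_simp
    simp

end Transformation


end LevelEleven

/-! ### Product formula and Lambert series -/

namespace LevelEleven

open Complex Filter Topology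

section QPochhammer

/-- The infinite product `∏ (1 - y Q ^ n)`, `n ≥ 0`. -/
noncomputable def qProd (Q y : ℂ) : ℂ := ∏' n : ℕ, (1 - y * Q ^ n)

/-- The Lambert series `∑ y Q ^ n / (1 - y Q ^ n)`, `n ≥ 0`. -/
noncomputable def lambert (Q y : ℂ) : ℂ := ∑' n : ℕ, y * Q ^ n / (1 - y * Q ^ n)

variable {Q : ℂ}

lemma summable_norm_neg_mul_pow (hQ : ‖Q‖ < 1) (y : ℂ) :
    Summable fun n : ℕ ↦ ‖-(y * Q ^ n)‖ := by
  simpa using (summable_geometric_of_lt_one (norm_nonneg _) hQ).mul_left ‖y‖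

lemma multipliable_qProd (hQ : ‖Q‖ < 1) (y : ℂ) : Multipliable fun n : ℕ ↦ 1 - y * Q ^ n := by
  simpa [sub_eq_add_neg] using! multipliable_one_add_of_summable (summable_norm_neg_mul_pow hQ y)

lemma one_sub_mul_pow_ne_zero (hQ : ‖Q‖ < 1) {y : ℂ} (hy : ‖y‖ < 1) (n : ℕ) :
    1 - y * Q ^ n ≠ 0 := by
  intro h
  have h1 : ‖y * Q ^ n‖ < 1 := by
    rw [norm_mul, norm_pow]
    exact mul_lt_one_of_nonneg_of_lt_one_left (norm_nonneg _) hy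
      (pow_le_one₀ (norm_nonneg _) hQ.le)
  rw [← sub_eq_zero.mp h] at h1
  simp at h1

lemma qProd_ne_zero (hQ : ‖Q‖ < 1) {y : ℂ} (hy : ‖y‖ < 1) : qProd Q y ≠ 0 := by
  have := tprod_one_add_ne_zero_of_summable (f := fun n : ℕ ↦ -(y * Q ^ n))
    (fun n ↦ by simpa [sub_eq_add_neg] using one_sub_mul_pow_ne_zero hQ hy n)
    (summable_norm_neg_mul_pow hQ y)
  simpa [qProd, sub_eq_add_neg] using this

lemma qProd_eq_one_sub_mul (hQ : ‖Q‖ < 1) (y : ℂ) :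
    qProd Q y = (1 - y) * qProd Q (y * Q) := by
  have hn : ∀ n : ℕ, 1 - y * Q ^ (n + 1) = 1 - y * Q * Q ^ n := fun n ↦ by ring
  rw [qProd, tprod_eq_zero_mul' (by simpa only [hn] using multipliable_qProd hQ (y * Q))]
  simp only [hn, pow_zero, mul_one, qProd]

lemma multipliableLocallyUniformlyOn_qProd (hQ : ‖Q‖ < 1) (R : ℝ) :
    MultipliableLocallyUniformlyOn (fun (n : ℕ) y ↦ 1 - y * Q ^ n) (Metric.ball (0 : ℂ) R) := by
  have := Summable.multipliableLocallyUniformlyOn_nat_one_add (K := Metric.ball (0 : ℂ) R)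
    (f := fun (n : ℕ) y ↦ -(y * Q ^ n)) (u := fun n ↦ R * ‖Q‖ ^ n) Metric.isOpen_ball
    ((summable_geometric_of_lt_one (norm_nonneg _) hQ).mul_left R)
    (Eventually.of_forall fun n y hy ↦ by
      rw [norm_neg, norm_mul, norm_pow]
      have : ‖y‖ ≤ R := by simpa using (Metric.mem_ball.mp hy).le
      gcongr) (fun n ↦ by fun_prop)
  simpa [sub_eq_add_neg] using! this

lemma differentiable_qProd (hQ : ‖Q‖ < 1) : Differentiable ℂ (qProd Q) := by
  intro y
  have h := (multipliableLocallyUniformlyOn_qProd hQ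
    (‖y‖ + 1)).hasProdLocallyUniformlyOn.differentiableOn
    (.of_forall fun _ ↦ by simpa [Finset.prod_fn] using
      DifferentiableOn.finsetProd (fun _ _ ↦ by fun_prop)) Metric.isOpen_ball
  exact h.differentiableAt (Metric.isOpen_ball.mem_nhds (by simp))

lemma summable_lambert (hQ : ‖Q‖ < 1) {y : ℂ} (hy : ‖y‖ < 1) :
    Summable fun n : ℕ ↦ y * Q ^ n / (1 - y * Q ^ n) := by
  refine Summable.of_norm_bounded (g := fun n ↦ (‖y‖ / (1 - ‖y‖)) * ‖Q‖ ^ n)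
    ((summable_geometric_of_lt_one (norm_nonneg _) hQ).mul_left _) fun n ↦ ?_
  have h1 : 1 - ‖y‖ ≤ ‖1 - y * Q ^ n‖ := by
    have h2 : ‖y * Q ^ n‖ ≤ ‖y‖ := by
      rw [norm_mul, norm_pow]
      exact mul_le_of_le_one_right (norm_nonneg _) (pow_le_one₀ (norm_nonneg _) hQ.le)
    have h3 := norm_sub_norm_le (1 : ℂ) (y * Q ^ n)
    rw [norm_one] at h3
    linarith
  rw [norm_div, norm_mul, norm_pow, div_mul_eq_mul_div]
  gcongr

/-- The product may be differentiated logarithmically factor by factor because it converges locally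
uniformly on the unit disc. -/
lemma logDeriv_qProd (hQ : ‖Q‖ < 1) {y : ℂ} (hy : ‖y‖ < 1) :
    y * logDeriv (qProd Q) y = -lambert Q y := by
  have hl : ∀ n : ℕ, logDeriv (fun y ↦ 1 - y * Q ^ n) y = -(Q ^ n / (1 - y * Q ^ n)) := by
    intro n
    rw [logDeriv_apply]
    have : HasDerivAt (fun y ↦ 1 - y * Q ^ n) (-(1 * Q ^ n)) y :=
      ((hasDerivAt_id y).mul_const (Q ^ n)).const_sub 1
    rw [this.deriv]; ring
  by_cases hy0 : y = 0
  · simp [hy0, lambert]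
  have hs : Summable fun n : ℕ ↦ logDeriv (fun y ↦ 1 - y * Q ^ n) y := by
    simp only [hl]
    refine ((summable_lambert hQ hy).mul_left (-y⁻¹)).congr fun n ↦ ?_
    field_simp
  have h := logDeriv_tprod_eq_tsum (s := Metric.ball (0 : ℂ) 1) Metric.isOpen_ball
    (x := y) (by simpa using hy) (f := fun (n : ℕ) y ↦ 1 - y * Q ^ n)
    (one_sub_mul_pow_ne_zero hQ hy) (fun n ↦ by fun_prop) hs
    (multipliableLocallyUniformlyOn_qProd hQ 1) (qProd_ne_zero hQ hy)
  have h' : logDeriv (qProd Q) y = ∑' n : ℕ, logDeriv (fun y ↦ 1 - y * Q ^ n) y := h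
  rw [h', lambert, ← tsum_mul_left, ← tsum_neg]
  refine tsum_congr fun n ↦ ?_
  rw [hl]; ring

end QPochhammer

lemma norm_cexp_two_pi_I_mul_lt_one {z : ℂ} (hz : 0 < z.im) :
    ‖exp (2 * Real.pi * I * z)‖ < 1 := by
  simpa using UpperHalfPlane.norm_exp_two_pi_I_lt_one ⟨z, hz⟩

/-- The product formula for the odd theta function. -/
theorem theta1_eq_qProd (z : ℂ) {τ : ℂ} (hτ : 0 < τ.im) :
    theta1 z τ = exp (Real.pi * I * (τ / 4 - z - 1 / 2)) *
      (qProd (exp (2 * Real.pi * I * τ)) (exp (2 * Real.pi * I * τ)) *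
        qProd (exp (2 * Real.pi * I * τ)) (exp (2 * Real.pi * I * z)) *
        qProd (exp (2 * Real.pi * I * τ)) (exp (2 * Real.pi * I * (τ - z)))) := by
  have hQ := norm_cexp_two_pi_I_mul_lt_one hτ
  set Q := exp (2 * Real.pi * I * τ) with hQdef
  rw [theta1_eq, jacobiTheta₂_eq_tprod _ hτ rfl rfl]
  have hq2 : exp (Real.pi * I * τ) ^ 2 = Q := by
    rw [← exp_nat_mul, hQdef]; congr 1; push_cast; ring
  have e1 : ∏' n : ℕ, (1 - (exp (Real.pi * I * τ) ^ 2) ^ (n + 1)) = qProd Q Q := by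
    rw [hq2, qProd]; simp only [pow_succ']
  have e2 : ∏' n : ℕ, (1 + exp (2 * Real.pi * I * (z + 1 / 2 + τ / 2)) *
      exp (Real.pi * I * τ) ^ (2 * n + 1)) = qProd Q (exp (2 * Real.pi * I * z) * Q) := by
    rw [qProd]
    refine tprod_congr fun n ↦ ?_
    rw [pow_succ, pow_mul, hq2, sub_eq_add_neg, ← neg_mul, ← exp_add, neg_cexp,
      mul_comm (Q ^ n), ← mul_assoc, ← exp_add]
    congr 3; ring
  have e3 : ∏' n : ℕ, (1 + (exp (2 * Real.pi * I * (z + 1 / 2 + τ / 2)))⁻¹ *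
      exp (Real.pi * I * τ) ^ (2 * n + 1)) = qProd Q (exp (-(2 * Real.pi * I * z))) := by
    rw [qProd]
    refine tprod_congr fun n ↦ ?_
    rw [pow_succ, pow_mul, hq2, sub_eq_add_neg, ← neg_mul, ← exp_neg, neg_cexp,
      mul_comm (Q ^ n), ← mul_assoc, ← exp_add]
    congr 2
    rw [exp_eq_exp_iff_exists_int]
    exact ⟨-1, by push_cast; ring⟩
  have e5 : exp (-(2 * Real.pi * I * z)) * Q = exp (2 * Real.pi * I * (τ - z)) := by
    rw [hQdef, ← exp_add]; congr 1; ring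
  -- The triple product has its factor of index 0 on the side of 1/x. Moving it to the side of x
  -- costs -1/x, absorbed in the exponential by `e4`.
  rw [e1, e2, e3, qProd_eq_one_sub_mul hQ (exp (-(2 * Real.pi * I * z))),
    qProd_eq_one_sub_mul hQ (exp (2 * Real.pi * I * z)), e5]
  have e4 : exp (Real.pi * I * (τ / 4 + z + 1 / 2)) =
      -(exp (Real.pi * I * (τ / 4 - z - 1 / 2)) * exp (2 * Real.pi * I * z)) := by
    rw [← exp_add, neg_cexp]
    congr 1; ring
  rw [e4, exp_neg]
  have := exp_ne_zero (2 * Real.pi * I * z)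
  field_simp
  ring

/-- In this strip all three products are taken at arguments of modulus less than 1, so no factor
vanishes. -/
lemma theta1_ne_zero {z τ : ℂ} (hz : 0 < z.im) (hzτ : z.im < τ.im) : theta1 z τ ≠ 0 := by
  have hτ : 0 < τ.im := hz.trans hzτ
  have hQ := norm_cexp_two_pi_I_mul_lt_one hτ
  rw [theta1_eq_qProd z hτ]
  refine mul_ne_zero (exp_ne_zero _) (mul_ne_zero (mul_ne_zero ?_ ?_) ?_) <;>
    refine qProd_ne_zero hQ (norm_cexp_two_pi_I_mul_lt_one ?_)
  · exact hτ
  · exact hz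
  · simpa using hzτ

lemma hasDerivAt_cexp_linear (c w z : ℂ) :
    HasDerivAt (fun z ↦ exp (c * (w + z))) (c * exp (c * (w + z))) z := by
  have h := (((hasDerivAt_id z).const_add w).const_mul c).cexp
  simpa [mul_comm] using! h

/-- The logarithmic derivative of the odd theta function as a Lambert series. -/
theorem logDeriv_theta1 {z τ : ℂ} (hz : 0 < z.im) (hzτ : z.im < τ.im) :
    logDeriv (theta1 · τ) z = -(Real.pi * I) - 2 * Real.pi * I *
      (lambert (exp (2 * Real.pi * I * τ)) (exp (2 * Real.pi * I * z)) -
        lambert (exp (2 * Real.pi * I * τ)) (exp (2 * Real.pi * I * (τ - z)))) := by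
  have hτ : 0 < τ.im := hz.trans hzτ
  have hQ := norm_cexp_two_pi_I_mul_lt_one hτ
  have hx := norm_cexp_two_pi_I_mul_lt_one hz
  have hy := norm_cexp_two_pi_I_mul_lt_one (z := τ - z) (by simpa using hzτ)
  have hf : (theta1 · τ) = fun z ↦ exp (Real.pi * I * (τ / 4 - z - 1 / 2)) *
      (qProd (exp (2 * Real.pi * I * τ)) (exp (2 * Real.pi * I * τ)) *
        qProd (exp (2 * Real.pi * I * τ)) (exp (2 * Real.pi * I * z)) *
        qProd (exp (2 * Real.pi * I * τ)) (exp (2 * Real.pi * I * (τ - z)))) :=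
    funext fun z ↦ theta1_eq_qProd z hτ
  set Q := exp (2 * Real.pi * I * τ) with hQdef
  have d0 : HasDerivAt (fun z ↦ exp (Real.pi * I * (τ / 4 - z - 1 / 2)))
      (-(Real.pi * I) * exp (Real.pi * I * (τ / 4 - z - 1 / 2))) z := by
    convert! hasDerivAt_cexp_linear (-(Real.pi * I)) (1 / 2 - τ / 4) z using 2
    · ring_nf
    · ring_nf
  have d1 : HasDerivAt (fun z ↦ exp (2 * Real.pi * I * z))
      (2 * Real.pi * I * exp (2 * Real.pi * I * z)) z := by
    simpa using hasDerivAt_cexp_linear (2 * Real.pi * I) 0 z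
  have d2 : HasDerivAt (fun z ↦ exp (2 * Real.pi * I * (τ - z)))
      (-(2 * Real.pi * I) * exp (2 * Real.pi * I * (τ - z))) z := by
    convert! hasDerivAt_cexp_linear (-(2 * Real.pi * I)) (-τ) z using 2
    · ring_nf
    · ring_nf
  have g1 := ((differentiable_qProd hQ _).hasDerivAt.comp z d1)
  have g2 := ((differentiable_qProd hQ _).hasDerivAt.comp z d2)
  have hh := d0.mul ((g1.const_mul (qProd Q Q)).mul g2)
  have h1 := logDeriv_qProd hQ hx
  have h2 := logDeriv_qProd hQ hy
  rw [logDeriv_apply] at h1 h2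
  have n0 := exp_ne_zero (Real.pi * I * (τ / 4 - z - 1 / 2))
  have n1 := qProd_ne_zero hQ hQ
  have n2 := qProd_ne_zero hQ hx
  have n3 := qProd_ne_zero hQ hy
  have hder := hh.congr_of_eventuallyEq (f₁ := (theta1 · τ)) (.of_forall (congrFun hf))
  rw [logDeriv_apply, hder.deriv, theta1_eq_qProd z hτ, sub_eq_add_neg (lambert _ _), ← h2,
    ← neg_eq_iff_eq_neg.mpr h1]
  simp only [Pi.mul_apply, Function.comp_apply, ← hQdef]
  clear_value Q
  generalize exp (2 * Real.pi * I * z) = X at *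
  generalize exp (2 * Real.pi * I * (τ - z)) = Y at *
  generalize exp (Real.pi * I * (τ / 4 - z - 1 / 2)) = E at *
  generalize deriv (qProd Q) X = X'
  generalize deriv (qProd Q) Y = Y'
  field_simp
  ring

/-- The derivative of the odd theta function at the origin is `-2π η³`. -/
theorem deriv_theta1_zero {τ : ℂ} (hτ : 0 < τ.im) :
    deriv (theta1 · τ) 0 = -2 * Real.pi * ModularForm.eta τ ^ 3 := by
  have hQ := norm_cexp_two_pi_I_mul_lt_one hτ
  -- Splitting off the simple zero at z = 0: only this factor contributes to the derivative there.
  have hf : (theta1 · τ) = fun z ↦ (1 - exp (2 * Real.pi * I * z)) *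
      (exp (Real.pi * I * (τ / 4 - z - 1 / 2)) *
      (qProd (exp (2 * Real.pi * I * τ)) (exp (2 * Real.pi * I * τ)) *
        qProd (exp (2 * Real.pi * I * τ)) (exp (2 * Real.pi * I * z) * exp (2 * Real.pi * I * τ)) *
        qProd (exp (2 * Real.pi * I * τ)) (exp (2 * Real.pi * I * (τ - z))))) := by
    funext z
    rw [theta1_eq_qProd z hτ, qProd_eq_one_sub_mul hQ (exp (2 * Real.pi * I * z))]
    ring
  have heta : ModularForm.eta τ = exp (Real.pi * I * τ / 12) *
      qProd (exp (2 * Real.pi * I * τ)) (exp (2 * Real.pi * I * τ)) := by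
    rw [ModularForm.eta, qProd, Function.Periodic.qParam]
    congr 1
    · congr 1; push_cast; ring
    · refine tprod_congr fun n ↦ ?_
      rw [ModularForm.eta_q_eq_pow, pow_succ']
  set Q := exp (2 * Real.pi * I * τ) with hQdef
  have d1 : HasDerivAt (fun z ↦ 1 - exp (2 * Real.pi * I * z))
      (-(2 * Real.pi * I * exp (2 * Real.pi * I * 0))) 0 := by
    simpa using (hasDerivAt_cexp_linear (2 * Real.pi * I) 0 0).const_sub 1
  have hdiff := differentiable_qProd hQ
  have d2 : DifferentiableAt ℂ (fun z ↦ exp (Real.pi * I * (τ / 4 - z - 1 / 2)) *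
      (qProd Q Q * qProd Q (exp (2 * Real.pi * I * z) * Q) *
        qProd Q (exp (2 * Real.pi * I * (τ - z))))) 0 := by
    fun_prop
  have hder := (d1.mul d2.hasDerivAt).congr_of_eventuallyEq (f₁ := (theta1 · τ))
    (.of_forall (congrFun hf))
  rw [hder.deriv, heta]
  simp only [mul_zero, exp_zero, sub_self, zero_mul, add_zero, mul_one, one_mul, sub_zero,
    ← hQdef]
  have e1 : exp (Real.pi * I * (τ / 4 - 1 / 2)) = exp (Real.pi * I * τ / 12) ^ 3 * -I := by
    rw [← exp_neg_pi_div_two_mul_I, ← exp_nat_mul, ← exp_add]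
    congr 1; push_cast; ring
  rw [e1]
  linear_combination (2 * Real.pi * (exp (Real.pi * I * τ / 12) * qProd Q Q) ^ 3) * I_sq

end LevelEleven

/-! ### Values of L-functions at 0 -/

namespace LevelEleven

open Complex Filter Topology HurwitzZeta Set

section HurwitzZero

lemma norm_ofReal_cpow_sub_le {N t u : ℝ} (hN : 1 ≤ N) (ht : t ∈ Icc N (N + 1))
    (hu : u ∈ Icc N (N + 1)) {s : ℂ} (hs : 0 < s.re) :
    ‖(t : ℂ) ^ (-s - 1) - (u : ℂ) ^ (-s - 1)‖ ≤ ‖s + 1‖ * (N ^ 2)⁻¹ := by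
  have key := Convex.norm_image_sub_le_of_norm_hasDerivWithin_le (𝕜 := ℝ)
    (f := fun t : ℝ ↦ (t : ℂ) ^ (-s - 1)) (f' := fun t : ℝ ↦ (-s - 1) * (t : ℂ) ^ (-s - 1 - 1))
    (C := ‖s + 1‖ * (N ^ 2)⁻¹) (s := Icc N (N + 1)) (x := u) (y := t) (fun v hv ↦ ?_)
    (fun v hv ↦ ?_) (convex_Icc _ _) hu ht
  · refine key.trans (mul_le_of_le_one_right (by positivity) ?_)
    rw [Real.norm_eq_abs, abs_le]
    constructor <;> linarith [ht.1, ht.2, hu.1, hu.2]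
  · have hv0 : 0 < v := by linarith [hv.1]
    have h := ((hasDerivAt_id (v : ℂ)).cpow_const (c := -s - 1)
      (Or.inl (by simpa using hv0))).comp_ofReal
    simpa using! h.hasDerivWithinAt
  · have hv1 : 1 ≤ v := hN.trans hv.1
    have hv0 : 0 < v := by linarith
    rw [norm_mul, norm_cpow_eq_rpow_re_of_pos hv0, ← norm_neg]
    have h1 : v ^ (-s - 1 - 1).re ≤ (N ^ 2)⁻¹ := by
      calc v ^ (-s - 1 - 1).re ≤ v ^ (-2 : ℝ) := by
            apply Real.rpow_le_rpow_of_exponent_le hv1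
            simp only [sub_re, neg_re, one_re]; linarith
        _ = (v ^ 2)⁻¹ := by rw [Real.rpow_neg hv0.le]; norm_cast
        _ ≤ (N ^ 2)⁻¹ := by
            have := hv.1
            gcongr
    rw [show -(-s - 1) = s + 1 by ring]
    gcongr

/-- The general term of the series continuing `hurwitzZetaOdd x s - s (1 / 2 - x) ζ(s + 1)`. -/
noncomputable def hurwitzOddTerm (x : ℝ) (N : ℝ) (s : ℂ) : ℂ :=
  (((N + x : ℝ) : ℂ) ^ (-s) - ((N + 1 - x : ℝ) : ℂ) ^ (-s)) / 2 -
    s * (1 / 2 - x) * ((N + 1 : ℝ) : ℂ) ^ (-s - 1)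

/-- Mean value inequality for t ^ (-s) + s (N+1) ^ (-s-1) t between N + 1 - x and N + x: the linear
correction makes the derivative of size N⁻². The decay gives convergence for Re s > 0, and the
factor ‖s‖ makes the series vanish as s → 0. -/
lemma norm_hurwitzOddTerm_le {x : ℝ} (hx : x ∈ Ioo (0 : ℝ) 1) {N : ℝ} (hN : 1 ≤ N) {s : ℂ}
    (hs : 0 < s.re) : ‖hurwitzOddTerm x N s‖ ≤ ‖s‖ * ‖s + 1‖ * (N ^ 2)⁻¹ := by
  have hxm : N + x ∈ Icc N (N + 1) := ⟨by linarith [hx.1], by linarith [hx.2]⟩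
  have hxm' : N + 1 - x ∈ Icc N (N + 1) := ⟨by linarith [hx.2], by linarith [hx.1]⟩
  have hNm : N + 1 ∈ Icc N (N + 1) := ⟨by linarith, le_rfl⟩
  have key := Convex.norm_image_sub_le_of_norm_hasDerivWithin_le (𝕜 := ℝ)
    (f := fun t : ℝ ↦ (t : ℂ) ^ (-s) + s * ((N + 1 : ℝ) : ℂ) ^ (-s - 1) * t)
    (f' := fun t : ℝ ↦ -s * ((t : ℂ) ^ (-s - 1) - ((N + 1 : ℝ) : ℂ) ^ (-s - 1)))
    (C := ‖s‖ * (‖s + 1‖ * (N ^ 2)⁻¹)) (s := Icc N (N + 1)) (x := N + 1 - x) (y := N + x)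
    (fun v hv ↦ ?_) (fun v hv ↦ ?_) (convex_Icc _ _) hxm' hxm
  · have h2 : hurwitzOddTerm x N s =
        (((N + x : ℝ) : ℂ) ^ (-s) + s * ((N + 1 : ℝ) : ℂ) ^ (-s - 1) * (N + x : ℝ) -
        (((N + 1 - x : ℝ) : ℂ) ^ (-s) + s * ((N + 1 : ℝ) : ℂ) ^ (-s - 1) * (N + 1 - x : ℝ))) / 2 := by
      rw [hurwitzOddTerm]; push_cast; ring
    rw [h2, norm_div]
    have h3 : ‖N + x - (N + 1 - x)‖ ≤ 1 := by
      rw [Real.norm_eq_abs, abs_le]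
      constructor <;> linarith [hx.1, hx.2]
    have h4 := key.trans (mul_le_of_le_one_right (by positivity) h3)
    have h5 : (0 : ℝ) ≤ ‖s‖ * (‖s + 1‖ * (N ^ 2)⁻¹) := by positivity
    rw [show ‖(2 : ℂ)‖ = 2 by simp]
    linarith
  · have hv0 : 0 < v := by linarith [hv.1]
    have h := (((hasDerivAt_id (v : ℂ)).cpow_const (c := -s)
      (Or.inl (by simpa using hv0))).add ((hasDerivAt_id (v : ℂ)).const_mul
        (s * ((N + 1 : ℝ) : ℂ) ^ (-s - 1)))).comp_ofReal
    convert! h.hasDerivWithinAt using 1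
    simp only [id]; ring
  · rw [norm_mul, norm_neg]
    gcongr
    exact norm_ofReal_cpow_sub_le hN hv hNm hs

lemma hasSum_hurwitzOddTerm {x : ℝ} (hx : x ∈ Ioo (0 : ℝ) 1) {s : ℂ} (hs : 1 < s.re) :
    HasSum (fun n : ℕ ↦ hurwitzOddTerm x n s)
      (hurwitzZetaOdd x s - s * (1 / 2 - x) * riemannZeta (s + 1)) := by
  have h1 := hasSum_nat_hurwitzZetaOdd_of_mem_Icc (Ioo_subset_Icc_self hx) hs
  have hs1 : 1 < (s + 1).re := by simp; linarith
  have h2 : HasSum (fun n : ℕ ↦ 1 / ((n : ℂ) + 1) ^ (s + 1)) (riemannZeta (s + 1)) := by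
    rw [zeta_eq_tsum_one_div_nat_add_one_cpow hs1]
    refine Summable.hasSum ?_
    exact_mod_cast (summable_nat_add_iff 1).mpr (summable_one_div_nat_cpow.mpr hs1)
  convert! h1.sub (h2.mul_left (s * (1 / 2 - x))) using 2 with n
  rw [hurwitzOddTerm, show -s - 1 = -(s + 1) by ring]
  simp only [cpow_neg, one_div]
  push_cast
  ring

/-- The value at `0` of the odd Hurwitz zeta function. -/
theorem hurwitzZetaOdd_zero {x : ℝ} (hx : x ∈ Ioo (0 : ℝ) 1) :
    hurwitzZetaOdd x 0 = 1 / 2 - x := by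
  -- A bounded region, for uniform estimates, containing 2, near which the defining series converge,
  -- and having 0 on its boundary.
  set U : Set ℂ := {s | 0 < s.re} ∩ Metric.ball 0 4 with hU
  have hUo : IsOpen U := (isOpen_lt continuous_const continuous_re).inter Metric.isOpen_ball
  have hUc : Convex ℝ U := (convex_halfSpace_re_gt 0).inter (convex_ball 0 4)
  have hsq : Summable fun n : ℕ ↦ (((n + 1 : ℕ) : ℝ) ^ 2)⁻¹ :=
    (summable_nat_add_iff 1).mpr (Real.summable_nat_pow_inv.mpr (by norm_num))
  have hpos : ∀ n : ℕ, (1 : ℝ) ≤ ((n + 1 : ℕ) : ℝ) := fun n ↦ by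
    push_cast; linarith [n.cast_nonneg (α := ℝ)]
  have hbound : ∀ (n : ℕ) (s : ℂ), 0 < s.re →
      ‖hurwitzOddTerm x (n + 1 : ℕ) s‖ ≤ ‖s‖ * ‖s + 1‖ * (((n + 1 : ℕ) : ℝ) ^ 2)⁻¹ :=
    fun n s hs ↦ norm_hurwitzOddTerm_le hx (hpos n) hs
  have hdiff : ∀ N : ℝ, 0 ≤ N → Differentiable ℂ (hurwitzOddTerm x N) := by
    intro N hN
    have h1 : ((N + x : ℝ) : ℂ) ≠ 0 := ofReal_ne_zero.mpr (by linarith [hx.1])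
    have h2 : ((N + 1 - x : ℝ) : ℂ) ≠ 0 := ofReal_ne_zero.mpr (by linarith [hx.2])
    have h3 : ((N + 1 : ℝ) : ℂ) ≠ 0 := ofReal_ne_zero.mpr (by linarith)
    intro s
    have d1 : DifferentiableAt ℂ (fun s : ℂ ↦ ((N + x : ℝ) : ℂ) ^ (-s)) s :=
      (differentiableAt_id.neg).const_cpow (Or.inl h1)
    have d2 : DifferentiableAt ℂ (fun s : ℂ ↦ ((N + 1 - x : ℝ) : ℂ) ^ (-s)) s :=
      (differentiableAt_id.neg).const_cpow (Or.inl h2)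
    have d3 : DifferentiableAt ℂ (fun s : ℂ ↦ ((N + 1 : ℝ) : ℂ) ^ (-s - 1)) s :=
      (differentiableAt_id.neg.sub_const 1).const_cpow (Or.inl h3)
    exact ((d1.sub d2).div_const 2).sub
      (((differentiableAt_id.mul_const _)).mul d3)
  -- The term N = 0 is kept apart because the bound requires N ≥ 1.
  set F : ℂ → ℂ := fun s ↦ ∑' n : ℕ, hurwitzOddTerm x (n + 1 : ℕ) s with hF
  have hFd : DifferentiableOn ℂ F U := by
    refine differentiableOn_tsum_of_summable_norm (hsq.mul_left 20)
      (fun n ↦ (hdiff _ (by positivity)).differentiableOn) hUo fun n s hs ↦ ?_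
    refine (hbound n s hs.1).trans ?_
    have h1 : ‖s‖ ≤ 4 := by simpa using (Metric.mem_ball.mp hs.2).le
    have h2 : ‖s + 1‖ ≤ 5 := (norm_add_le _ _).trans (by rw [norm_one]; linarith)
    have : ‖s‖ * ‖s + 1‖ ≤ 20 := by nlinarith [norm_nonneg s, norm_nonneg (s + 1)]
    gcongr
  have heq : EqOn (fun s ↦ hurwitzZetaOdd x s - s * (1 / 2 - x) * riemannZeta (s + 1))
      (fun s ↦ hurwitzOddTerm x (0 : ℕ) s + F s) U := by
    refine AnalyticOnNhd.eqOn_of_preconnected_of_eventuallyEq (z₀ := 2)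
      (DifferentiableOn.analyticOnNhd ?_ hUo) (DifferentiableOn.analyticOnNhd ?_ hUo)
      hUc.isPreconnected (by simp [hU]; norm_num) ?_
    · intro s hs
      have hs0 : s ≠ 0 := fun h ↦ by simp [h, hU] at hs
      refine DifferentiableAt.differentiableWithinAt ?_
      refine ((differentiable_hurwitzZetaOdd _) s).sub ((differentiableAt_id.mul_const _).mul ?_)
      exact (differentiableAt_riemannZeta (by simpa using hs0)).comp s
        (f := fun s ↦ s + 1) (by fun_prop)
    · exact (hdiff _ (by simp)).differentiableOn.add hFd
    · filter_upwards [(isOpen_lt continuous_const continuous_re).mem_nhds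
        (show (1 : ℝ) < (2 : ℂ).re by norm_num)] with s hs
      have h := hasSum_hurwitzOddTerm hx hs
      rw [← h.tsum_eq, h.summable.tsum_eq_zero_add]
  have hr : Tendsto (fun r : ℝ ↦ (r : ℂ)) (𝓝[>] 0) (𝓝 0) :=
    (continuous_ofReal.tendsto' 0 0 (by simp)).mono_left nhdsWithin_le_nhds
  have hl1 : Tendsto (fun r : ℝ ↦ hurwitzZetaOdd x (r : ℂ)) (𝓝[>] 0) (𝓝 (hurwitzZetaOdd x 0)) :=
    ((differentiable_hurwitzZetaOdd x).continuous.tendsto 0).comp hr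
  have hl2 : Tendsto (fun r : ℝ ↦ (r : ℂ) * riemannZeta (r + 1)) (𝓝[>] 0) (𝓝 1) := by
    have h1 : Tendsto (fun r : ℝ ↦ (r : ℂ) + 1) (𝓝[>] 0) (𝓝[≠] 1) := by
      refine tendsto_nhdsWithin_iff.mpr ⟨by simpa using hr.add_const 1, ?_⟩
      filter_upwards [self_mem_nhdsWithin] with r hr'
      simpa using ne_of_gt hr'
    exact (riemannZeta_residue_one.comp h1).congr fun r ↦ by simp
  have hl3 : Tendsto (fun r : ℝ ↦ hurwitzOddTerm x (0 : ℕ) (r : ℂ)) (𝓝[>] 0) (𝓝 0) := by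
    have := ((hdiff ((0 : ℕ) : ℝ) (by simp)).continuous.tendsto 0).comp hr
    rwa [show hurwitzOddTerm x (0 : ℕ) 0 = 0 by simp [hurwitzOddTerm]] at this
  have hl4 : Tendsto (fun r : ℝ ↦ F (r : ℂ)) (𝓝[>] 0) (𝓝 0) := by
    refine squeeze_zero_norm' (a := fun r : ℝ ↦ ‖(r : ℂ)‖ * ‖(r : ℂ) + 1‖ *
      ∑' n : ℕ, (((n + 1 : ℕ) : ℝ) ^ 2)⁻¹) ?_ ?_
    · filter_upwards [self_mem_nhdsWithin] with r hr'
      rw [← tsum_mul_left]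
      exact tsum_of_norm_bounded (hsq.mul_left _).hasSum fun n ↦ hbound n r (by simpa using hr')
    · have := ((hr.norm.mul ((hr.add_const 1).norm)).mul_const
        (∑' n : ℕ, (((n + 1 : ℕ) : ℝ) ^ 2)⁻¹))
      simpa using this
  -- As r → 0⁺, r ζ(r + 1) → 1 while the continued series tends to 0, which leaves the value 1/2 -
  -- x.
  have hlim := (hl1.sub (hl2.mul_const ((1 / 2 - x : ℂ)))).congr' (f₂ := fun r : ℝ ↦
      hurwitzOddTerm x (0 : ℕ) (r : ℂ) + F r) (by
    filter_upwards [Ioo_mem_nhdsGT (show (0 : ℝ) < 4 by norm_num)] with r hr'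
    have := heq (show (r : ℂ) ∈ U from ⟨by simpa using hr'.1, by
      simpa [abs_of_pos hr'.1] using hr'.2⟩)
    simp only at this
    rw [← this]; ring)
  have h := tendsto_nhds_unique hlim (hl3.add hl4)
  linear_combination h

end HurwitzZero

/-- The value at `0` of the L-function of an odd function on `ℤ / N`. -/
theorem LFunction_zero_of_odd {N : ℕ} [NeZero N] {Φ : ZMod N → ℂ} (hΦ : Φ.Odd) :
    ZMod.LFunction Φ 0 = -(∑ j : ZMod N, Φ j * (j.val : ℂ)) / N := by
  have h0 : Φ 0 = 0 := by
    have := hΦ 0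
    rw [neg_zero] at this
    exact self_eq_neg.mp this
  have hsum : ∑ j : ZMod N, Φ j = 0 := by
    have h1 := Equiv.sum_comp (Equiv.neg (ZMod N)) Φ
    simp only [Equiv.neg_apply, hΦ _, Finset.sum_neg_distrib] at h1
    exact self_eq_neg.mp h1.symm
  have hN : (N : ℂ) ≠ 0 := NeZero.ne _
  rw [ZMod.LFunction_def_odd hΦ, neg_zero, cpow_zero, one_mul]
  -- The residue 0, excluded from the Hurwitz formula, is harmless because Φ 0 = 0.
  have hterm : ∀ j : ZMod N, Φ j * hurwitzZetaOdd (ZMod.toAddCircle j) 0 =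
      Φ j * (1 / 2) - Φ j * (j.val : ℂ) / N := by
    intro j
    by_cases hj : j = 0
    · simp [hj, h0]
    · have hNpos : (0 : ℝ) < N := by exact_mod_cast Nat.pos_of_ne_zero (NeZero.ne N)
      have hval : 0 < j.val := Nat.pos_of_ne_zero (by simpa using hj)
      rw [ZMod.toAddCircle_apply, hurwitzZetaOdd_zero ⟨by positivity, by
        rw [div_lt_one hNpos]; exact_mod_cast j.val_lt⟩]
      push_cast; ring
  simp only [hterm, Finset.sum_sub_distrib, ← Finset.sum_mul, hsum, ← Finset.sum_div]
  ring

end LevelEleven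

/-! ### Odd characters modulo 11 and the Eisenstein sum -/

namespace LevelEleven

open Complex

section OddCharacters

lemma isPrimitive_of_odd {p : ℕ} [hp : Fact p.Prime] {χ : DirichletCharacter ℂ p} (hχ : χ.Odd) :
    χ.IsPrimitive := by
  rcases (Nat.dvd_prime hp.out).mp χ.conductor_dvd_level with h | h
  · rw [χ.eq_one_iff_conductor_eq_one.symm] at h
    rw [h, DirichletCharacter.Odd] at hχ
    rw [MulChar.one_apply (isUnit_one.neg)] at hχ
    norm_num at hχ
  · exact h

open Classical in
-- The expression (χ(a) - χ(-a))/2 is χ(a) for odd χ and 0 for even χ, so orthogonality over all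
-- characters applies. Primitivity is automatic at prime level.
lemma sum_odd_characters {p : ℕ} [hp : Fact p.Prime] (a : ZMod p) :
    ∑ χ ∈ (Finset.univ : Finset (DirichletCharacter ℂ p)).filter
      (fun χ ↦ χ.Odd ∧ χ.IsPrimitive), χ a =
    ((p : ℂ) - 1) / 2 * ((if a = 1 then 1 else 0) - (if a = -1 then 1 else 0)) := by
  have h1 : ∀ χ : DirichletCharacter ℂ p, (if χ.Odd ∧ χ.IsPrimitive then χ a else 0) =
      (χ a - χ (-a)) / 2 := by
    intro χ
    rcases χ.even_or_odd with h | h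
    · rw [if_neg (fun h' ↦ h.not_odd _ h'.1), h.eval_neg _ a]; ring
    · rw [if_pos ⟨h, isPrimitive_of_odd h⟩, h.eval_neg _ a]; ring
  rw [Finset.sum_filter, Finset.sum_congr rfl fun χ _ ↦ h1 χ, ← Finset.sum_div,
    Finset.sum_sub_distrib, DirichletCharacter.sum_characters_eq,
    DirichletCharacter.sum_characters_eq, Nat.totient_prime hp.out,
    Nat.cast_sub hp.out.one_lt.le]
  simp only [neg_eq_iff_eq_neg, Nat.cast_one]
  split_ifs <;> ring

lemma fact_prime_eleven : Fact (Nat.Prime 11) := ⟨by norm_num⟩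

attribute [local instance] fact_prime_eleven

lemma sum_zmod_eleven (f : ZMod 11 → ℂ) : ∑ j, f j =
    f 0 + f 1 + f 2 + f 3 + f 4 + f 5 + f 6 + f 7 + f 8 + f 9 + f 10 := by
  rw [show (Finset.univ : Finset (ZMod 11)) = {0, 1, 2, 3, 4, 5, 6, 7, 8, 9, 10} from rfl]
  iterate 10 rw [Finset.sum_insert (by decide)]
  rw [Finset.sum_singleton]
  ring

/-- The inverse of `L(0, χ) / 2` for odd characters modulo `11`. -/
lemma LFunction_zero_mul_eleven {χ : DirichletCharacter ℂ 11} (hχ : χ.Odd) :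
    χ.LFunction 0 * (χ 1 + χ 6 + χ 4 + χ 9) = 2 := by
  have h0 : χ 0 = 0 := χ.map_zero
  have h1 : χ 1 = 1 := χ.map_one
  have hneg : ∀ a, χ (-a) = -χ a := fun a ↦ hχ.eval_neg _ a
  -- As 2 is a primitive root modulo 11, all values are powers of ω = χ 2 with ω ^ 5 = -1, and the
  -- claim is a polynomial identity modulo ω ^ 5 + 1. The residues 6, 4, 9 are the inverses of 2, 3,
  -- 5.
  have h4 : χ 4 = χ 2 ^ 2 := by rw [← map_pow]; rfl
  have h8 : χ 8 = χ 2 ^ 3 := by rw [← map_pow]; rfl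
  have h5 : χ 5 = χ 2 ^ 4 := by rw [← map_pow]; rfl
  have h10' : χ 10 = χ 2 ^ 5 := by rw [← map_pow]; rfl
  have h10 : χ 10 = -1 := by rw [← h1, ← hneg]; rfl
  have h9 : χ 9 = -χ 2 := by rw [← hneg]; rfl
  have h7 : χ 7 = -χ 2 ^ 2 := by rw [← h4, ← hneg]; rfl
  have h3 : χ 3 = -χ 2 ^ 3 := by rw [← h8, ← hneg]; rfl
  have h6 : χ 6 = -χ 2 ^ 4 := by rw [← h5, ← hneg]; rfl
  have hω : χ 2 ^ 5 = -1 := by rw [← h10', h10]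
  have hsum : ∑ j : ZMod 11, χ j * (j.val : ℂ) =
      -9 - 7 * χ 2 - 3 * χ 2 ^ 2 + 5 * χ 2 ^ 3 - χ 2 ^ 4 := by
    rw [sum_zmod_eleven]
    simp only [h0, h1, h3, h4, h5, h6, h7, h8, h9, h10]
    simp [show ZMod.val (1 : ZMod 11) = 1 from rfl, show ZMod.val (2 : ZMod 11) = 2 from rfl,
      show ZMod.val (3 : ZMod 11) = 3 from rfl, show ZMod.val (4 : ZMod 11) = 4 from rfl,
      show ZMod.val (5 : ZMod 11) = 5 from rfl, show ZMod.val (6 : ZMod 11) = 6 from rfl,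
      show ZMod.val (7 : ZMod 11) = 7 from rfl, show ZMod.val (8 : ZMod 11) = 8 from rfl,
      show ZMod.val (9 : ZMod 11) = 9 from rfl, show ZMod.val (10 : ZMod 11) = 10 from rfl]
    ring
  rw [DirichletCharacter.LFunction, LFunction_zero_of_odd hχ.to_fun, hsum, h1, h6, h4, h9]
  push_cast
  linear_combination (1 / 11 * (-13 - 2 * χ 2 + 5 * χ 2 ^ 2 - χ 2 ^ 3)) * hω

lemma mul_eq_iff_zmod_eleven (n : ZMod 11) :
    (n * 1 = 1 ↔ n = 1) ∧ (n * 6 = 1 ↔ n = 2) ∧ (n * 4 = 1 ↔ n = 3) ∧ (n * 9 = 1 ↔ n = 5) ∧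
    (n * 1 = -1 ↔ n = -1) ∧ (n * 6 = -1 ↔ n = -2) ∧ (n * 4 = -1 ↔ n = -3) ∧
    (n * 9 = -1 ↔ n = -5) := by
  revert n; decide

/-- The odd function on `ℤ / 11` with value `1` on `1, 2, 3, 5` and `0` on `4`. -/
noncomputable def eisCoeff (n : ZMod 11) : ℂ :=
  (if n = 1 then 1 else 0) + (if n = 2 then 1 else 0) + (if n = 3 then 1 else 0) +
    (if n = 5 then 1 else 0) - (if n = -1 then 1 else 0) - (if n = -2 then 1 else 0) -
    (if n = -3 then 1 else 0) - (if n = -5 then 1 else 0)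

open Classical in
-- Replacing 2/L(0,χ) by a sum of four character values reduces this to orthogonality, which selects
-- n ≡ ±1, ±2, ±3, ±5.
lemma sum_odd_characters_div_LFunction (n : ZMod 11) :
    2 / (((11 : ℕ) : ℂ) - 1) * ∑ χ ∈ (Finset.univ : Finset (DirichletCharacter ℂ 11)).filter
      (fun χ ↦ χ.Odd ∧ χ.IsPrimitive), 2 / χ.LFunction 0 * χ n = eisCoeff n := by
  have h1 : ∀ χ ∈ (Finset.univ : Finset (DirichletCharacter ℂ 11)).filter
      (fun χ ↦ χ.Odd ∧ χ.IsPrimitive), 2 / χ.LFunction 0 * χ n =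
      χ (n * 1) + χ (n * 6) + χ (n * 4) + χ (n * 9) := by
    intro χ hχ
    have h := LFunction_zero_mul_eleven (Finset.mem_filter.mp hχ).2.1
    have hL : χ.LFunction 0 ≠ 0 := by
      intro h0
      rw [h0, zero_mul] at h
      norm_num at h
    rw [map_mul, map_mul, map_mul, map_mul]
    field_simp
    linear_combination -χ n * h
  rw [Finset.sum_congr rfl h1]
  simp only [Finset.sum_add_distrib, sum_odd_characters, eisCoeff]
  obtain ⟨e1, e2, e3, e4, f1, f2, f3, f4⟩ := mul_eq_iff_zmod_eleven n
  simp only [e1, e2, e3, e4, f1, f2, f3, f4]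
  push_cast
  ring

end OddCharacters

section EisensteinSum

attribute [local instance] fact_prime_eleven

lemma summable_pow_div_one_sub_pow {q : ℂ} (hq : ‖q‖ < 1) :
    Summable fun n : ℕ ↦ ‖q ^ (n + 1) / (1 - q ^ (n + 1))‖ := by
  simpa only [pow_succ'] using (summable_lambert hq hq).norm

/-- The Eisenstein series `𝓔₁₁` as a combination of Lambert series. -/
theorem eisSum_eleven_eq (τ : ℍ) : eisSum 11 τ = 1 + ∑ j : ZMod 11, eisCoeff j *
    lambert (exp (2 * Real.pi * I * τ) ^ 11) (exp (2 * Real.pi * I * τ) ^ j.val) := by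
  classical
  have hq : ‖exp (2 * Real.pi * I * τ)‖ < 1 := norm_cexp_two_pi_I_mul_lt_one τ.im_pos
  rw [eisSum]
  simp only [eisSeries]
  generalize exp (2 * Real.pi * I * τ) = q at hq ⊢
  set O := (Finset.univ : Finset (DirichletCharacter ℂ 11)).filter
      (fun χ ↦ χ.Odd ∧ χ.IsPrimitive) with hO
  set A : ℕ → ℂ := fun n ↦ q ^ n / (1 - q ^ n) with hA
  have hsA : Summable fun n : ℕ ↦ ‖A (n + 1)‖ := summable_pow_div_one_sub_pow hq
  have hsχ : ∀ χ : DirichletCharacter ℂ 11,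
      Summable fun n : ℕ ↦ χ ((n + 1 : ℕ) : ZMod 11) * A (n + 1) := fun χ ↦ by
    refine Summable.of_norm_bounded hsA fun n ↦ ?_
    rw [norm_mul]
    exact mul_le_of_le_one_left (norm_nonneg _) (χ.norm_le_one _)
  have hcard : 2 / (((11 : ℕ) : ℂ) - 1) * ∑ χ ∈ O, (1 : ℂ) = 1 := by
    have h := sum_odd_characters (p := 11) 1
    simp only [map_one] at h
    rw [h, if_neg (show ¬ (1 : ZMod 11) = -1 by decide), if_pos trivial]
    norm_num
  have hterm : ∀ χ : DirichletCharacter ℂ 11,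
      (1 + 2 / χ.LFunction (1 - ((1 : ℕ) : ℂ)) * ∑' n : ℕ, χ ((n + 1 : ℕ) : ZMod 11) *
        ((n + 1 : ℕ) : ℂ) ^ (1 - 1) * q ^ (n + 1) / (1 - q ^ (n + 1))) =
      1 + ∑' n : ℕ, 2 / χ.LFunction 0 * χ ((n + 1 : ℕ) : ZMod 11) * A (n + 1) := by
    intro χ
    rw [Nat.cast_one, sub_self, ← tsum_mul_left]
    congr 1
    refine tsum_congr fun n ↦ ?_
    simp only [hA, Nat.sub_self, pow_zero]
    ring
  have hsum : Summable fun n : ℕ ↦ eisCoeff ((n + 1 : ℕ) : ZMod 11) * A (n + 1) := by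
    simp only [← sum_odd_characters_div_LFunction, mul_assoc, Finset.sum_mul]
    exact (summable_sum fun χ _ ↦ (hsχ χ).mul_left _).mul_left _
  have hsum' : Summable fun n : ℕ ↦ eisCoeff (n : ZMod 11) * A n :=
    (summable_nat_add_iff 1).mp hsum
  -- The coefficient vanishes at 0, so the index n = 0 can be included and the series split into
  -- full residue classes.
  have h0 : eisCoeff ((0 : ℕ) : ZMod 11) = 0 := by
    rw [← sum_odd_characters_div_LFunction]
    simp [fun χ : DirichletCharacter ℂ 11 ↦ χ.map_zero]
  rw [Finset.sum_congr rfl fun χ _ ↦ hterm χ, Finset.sum_add_distrib, mul_add, hcard,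
    ← Summable.tsum_finsetSum (fun χ _ ↦ by simpa only [mul_assoc] using (hsχ χ).mul_left _),
    ← tsum_mul_left]
  congr 1
  have h1 : ∀ n : ℕ, 2 / (((11 : ℕ) : ℂ) - 1) *
      ∑ χ ∈ O, 2 / χ.LFunction 0 * χ ((n + 1 : ℕ) : ZMod 11) * A (n + 1) =
      eisCoeff ((n + 1 : ℕ) : ZMod 11) * A (n + 1) := by
    intro n
    rw [← sum_odd_characters_div_LFunction, ← Finset.sum_mul, mul_assoc]
  rw [tsum_congr h1]
  have h2 := hsum'.tsum_eq_zero_add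
  rw [h0, zero_mul, zero_add] at h2
  rw [← h2, Nat.sumByResidueClasses hsum' 11]
  refine Finset.sum_congr rfl fun j _ ↦ ?_
  rw [lambert, ← tsum_mul_left]
  refine tsum_congr fun m ↦ ?_
  have : ((j.val + 11 * m : ℕ) : ZMod 11) = j := by
    push_cast
    rw [ZMod.natCast_zmod_val, show (11 : ZMod 11) = 0 from rfl]; ring
  rw [this]
  simp only [hA, pow_add, pow_mul]

end EisensteinSum

end LevelEleven

/-! ### Theta and zeta values at multiples of τ -/

namespace LevelEleven

open Complex

section LevelElevenValues

lemma logDeriv_theta1_neg (z : ℂ) (τ : ℂ) :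
    logDeriv (theta1 · τ) (-z) = -logDeriv (theta1 · τ) z := by
  have h : deriv (theta1 · τ) (-z) = deriv (theta1 · τ) z := by
    have h1 := deriv_comp_neg (theta1 · τ) z
    have h2 : (fun w ↦ theta1 (-w) τ) = fun w ↦ -theta1 w τ := funext fun w ↦ theta1_neg w τ
    rw [h2, deriv.fun_neg] at h1
    linear_combination h1
  rw [logDeriv_apply, logDeriv_apply, h, theta1_neg, div_neg]

lemma logDeriv_theta1_add_one (z τ : ℂ) :
    logDeriv (theta1 · τ) (z + 1) = logDeriv (theta1 · τ) z := by
  have h : deriv (theta1 · τ) (z + 1) = -deriv (theta1 · τ) z := by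
    rw [← deriv_comp_add_const, ← deriv.fun_neg]
    simp only [theta1_add_one]
  rw [logDeriv_apply, logDeriv_apply, h, theta1_add_one, neg_div_neg_eq]

lemma logDeriv_theta1_add_int (z τ : ℂ) (n : ℤ) :
    logDeriv (theta1 · τ) (z + n) = logDeriv (theta1 · τ) z := by
  have : Function.Periodic (logDeriv (theta1 · τ)) 1 := fun z ↦ logDeriv_theta1_add_one z τ
  simpa using this.int_mul n z

lemma theta1_add_int (z τ : ℂ) (n : ℤ) : theta1 (z + n) τ = (-1) ^ n * theta1 z τ := by
  induction n with
  | zero => simp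
  | succ n ih =>
    push_cast at ih ⊢
    rw [← add_assoc, theta1_add_one, ih, zpow_add_one₀ (by norm_num)]; ring
  | pred n ih =>
    have h := theta1_add_one (z + ((-n - 1 : ℤ) : ℂ)) τ
    rw [show z + ((-n - 1 : ℤ) : ℂ) + 1 = z + ((-n : ℤ) : ℂ) by push_cast; ring, ih] at h
    rw [zpow_sub_one₀ (by norm_num)]
    linear_combination h

/-- The constant comes from the quasi-period factor; the term 2πi j / 11 in `zetaVal` is designed to
cancel it when j grows by 11. -/
lemma logDeriv_theta1_add_tau {z τ : ℂ} (hτ : 0 < τ.im) (hz : theta1 z τ ≠ 0) :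
    logDeriv (theta1 · τ) (z + τ) = logDeriv (theta1 · τ) z - 2 * Real.pi * I := by
  have h1 : HasDerivAt (fun w ↦ exp (2 * (-Real.pi * I) * (τ / 2 + w)))
      (2 * (-Real.pi * I) * exp (2 * (-Real.pi * I) * (τ / 2 + z))) z :=
    hasDerivAt_cexp_linear _ _ _
  have hd := (differentiable_theta1 hτ z).hasDerivAt
  have h2 := (h1.mul hd).neg
  have h3 : deriv (theta1 · τ) (z + τ) = _ := (deriv_comp_add_const (theta1 · τ) τ z).symm.trans
    ((h2.congr_of_eventuallyEq (f₁ := fun w ↦ theta1 (w + τ) τ) (.of_forall fun w ↦ by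
      simp only [theta1_add_tau, Pi.neg_apply, Pi.mul_apply]
      rw [neg_mul]
      congr 3; ring)).deriv)
  rw [logDeriv_apply, logDeriv_apply, h3, theta1_add_tau,
    show -Real.pi * I * (τ + 2 * z) = 2 * (-Real.pi * I) * (τ / 2 + z) by ring]
  have := exp_ne_zero (2 * (-Real.pi * I) * (τ / 2 + z))
  field_simp
  ring

/-- The values `e^{πi j² τ / 11} θ(j τ, 11 τ)`. -/
noncomputable def thetaVal (τ : ℂ) (j : ℤ) : ℂ :=
  exp (Real.pi * I * j ^ 2 * τ / 11) * theta1 (j * τ) (11 * τ)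

/-- The values at `j τ` of the logarithmic derivative of `θ(·, 11 τ)`, made periodic in `j`. -/
noncomputable def zetaVal (τ : ℂ) (j : ℤ) : ℂ :=
  logDeriv (theta1 · (11 * τ)) (j * τ) + 2 * Real.pi * I * j / 11

lemma thetaVal_neg (τ : ℂ) (j : ℤ) : thetaVal τ (-j) = -thetaVal τ j := by
  rw [thetaVal, thetaVal]
  push_cast
  rw [neg_mul, theta1_neg, neg_sq, mul_neg]

/-- The Gaussian factor exactly offsets the quasi-period exponential, and only the sign remains. -/
lemma thetaVal_add_eleven (τ : ℂ) (j : ℤ) : thetaVal τ (j + 11) = -thetaVal τ j := by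
  rw [thetaVal, thetaVal]
  push_cast
  rw [show ((j : ℂ) + 11) * τ = j * τ + 11 * τ by ring, theta1_add_tau, neg_mul, mul_neg,
    ← mul_assoc, ← exp_add]
  congr 3
  ring

lemma thetaVal_add_mul_eleven (τ : ℂ) (j m : ℤ) :
    thetaVal τ (j + 11 * m) = (-1) ^ m * thetaVal τ j := by
  induction m with
  | zero => simp
  | succ m ih =>
    rw [show j + 11 * ((m : ℤ) + 1) = j + 11 * m + 11 by ring, thetaVal_add_eleven, ih,
      zpow_add_one₀ (by norm_num)]; ring
  | pred m ih =>
    have h := thetaVal_add_eleven τ (j + 11 * (-m - 1))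
    rw [show j + 11 * (-(m : ℤ) - 1) + 11 = j + 11 * -m by ring, ih] at h
    rw [zpow_sub_one₀ (by norm_num)]
    linear_combination h

lemma thetaVal_ne_zero (τ : ℍ) {j : ℤ} (hj : ¬ (11 ∣ j)) : thetaVal τ j ≠ 0 := by
  have h := thetaVal_add_mul_eleven τ (j % 11) (j / 11)
  rw [Int.emod_add_mul_ediv] at h
  rw [h]
  have hpos : 0 < j % 11 := by omega
  have hlt : j % 11 < 11 := by omega
  refine mul_ne_zero (zpow_ne_zero _ (by norm_num)) (mul_ne_zero (exp_ne_zero _)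
    (theta1_ne_zero ?_ ?_))
  · rw [← ofReal_intCast, im_ofReal_mul]
    exact mul_pos (by exact_mod_cast hpos) τ.im_pos
  · rw [← ofReal_intCast, im_ofReal_mul, show (11 : ℂ) = ((11 : ℝ) : ℂ) by norm_num, im_ofReal_mul]
    exact mul_lt_mul_of_pos_right (by exact_mod_cast hlt) τ.im_pos

lemma theta1_mul_ne_zero (τ : ℍ) {j : ℤ} (hj : ¬ (11 ∣ j)) :
    theta1 (j * τ) (11 * τ) ≠ 0 := fun h ↦
  thetaVal_ne_zero τ hj (by rw [thetaVal, h, mul_zero])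

lemma eleven_mul_im_pos (τ : ℍ) : 0 < (11 * (τ : ℂ)).im := by
  rw [show (11 : ℂ) = ((11 : ℝ) : ℂ) by norm_num, im_ofReal_mul]
  exact mul_pos (by norm_num) τ.im_pos

lemma zetaVal_neg (τ : ℂ) (j : ℤ) : zetaVal τ (-j) = -zetaVal τ j := by
  rw [zetaVal, zetaVal]
  push_cast
  rw [neg_mul, logDeriv_theta1_neg]
  ring

lemma zetaVal_add_eleven (τ : ℍ) {j : ℤ} (hj : ¬ (11 ∣ j)) :
    zetaVal τ (j + 11) = zetaVal τ j := by
  rw [zetaVal, zetaVal]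
  push_cast
  rw [show ((j : ℂ) + 11) * τ = j * τ + 11 * τ by ring,
    logDeriv_theta1_add_tau (eleven_mul_im_pos τ) (theta1_mul_ne_zero τ hj)]
  ring

lemma zetaVal_congr (τ : ℍ) {j k : ℤ} (hj : ¬ (11 ∣ j)) (h : (j : ZMod 11) = k) :
    zetaVal τ j = zetaVal τ k := by
  have key : ∀ (n : ℕ) {j : ℤ}, ¬ (11 ∣ j) → zetaVal τ (j + 11 * n) = zetaVal τ j := by
    intro n j hj
    induction n with
    | zero => simp
    | succ n ih =>
      push_cast
      rw [mul_add, mul_one, ← add_assoc, zetaVal_add_eleven τ (by omega), ih]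
  have hd : (11 : ℤ) ∣ k - j := (ZMod.intCast_eq_intCast_iff_dvd_sub j k 11).mp h
  obtain ⟨m, hm⟩ := hd
  rcases le_total 0 m with h0 | h0
  · obtain ⟨n, rfl⟩ := Int.eq_ofNat_of_zero_le h0
    rw [← key n hj]; congr 1; omega
  · obtain ⟨n, hn⟩ := Int.eq_ofNat_of_zero_le (neg_nonneg.mpr h0)
    rw [← key n (j := k) (by omega)]; congr 1; omega

/-- The theta values satisfy the three-term relation. -/
theorem thetaVal_three_term (τ : ℍ) (a b c d : ℤ) :
    thetaVal τ (a + b) * thetaVal τ (a - b) * (thetaVal τ (c + d) * thetaVal τ (c - d)) -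
      thetaVal τ (a + c) * thetaVal τ (a - c) * (thetaVal τ (b + d) * thetaVal τ (b - d)) +
      thetaVal τ (a + d) * thetaVal τ (a - d) * (thetaVal τ (b + c) * thetaVal τ (b - c)) = 0 := by
  have h := theta1_three_term (a * τ) (b * τ) (c * τ) (d * τ) (eleven_mul_im_pos τ)
  -- Since (a + b)² + (a - b)² = 2a² + 2b², the three terms carry one common Gaussian factor.
  have he : ∀ a b : ℤ, thetaVal τ (a + b) * thetaVal τ (a - b) =
      exp (2 * Real.pi * I * a ^ 2 * τ / 11) * exp (2 * Real.pi * I * b ^ 2 * τ / 11) *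
      (theta1 (a * τ + b * τ) (11 * τ) * theta1 (a * τ - b * τ) (11 * τ)) := by
    intro a b
    rw [thetaVal, thetaVal, mul_mul_mul_comm, ← exp_add, ← exp_add]
    push_cast
    rw [add_mul, sub_mul]
    congr 2
    ring
  rw [he, he, he, he, he, he]
  linear_combination (exp (2 * Real.pi * I * a ^ 2 * τ / 11) *
    exp (2 * Real.pi * I * b ^ 2 * τ / 11) * exp (2 * Real.pi * I * c ^ 2 * τ / 11) *
    exp (2 * Real.pi * I * d ^ 2 * τ / 11)) * h

/-- A sum of four zeta values as a quotient of theta values. -/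
theorem zetaVal_add (τ : ℍ) {s : ℤ} (hs : ¬ (11 ∣ s)) :
    zetaVal τ s + zetaVal τ (2 * s) + zetaVal τ (3 * s) + zetaVal τ (5 * s) =
      -2 * Real.pi * ModularForm.eta (11 * τ) ^ 3 * (thetaVal τ (4 * s) * thetaVal τ (5 * s) /
        (thetaVal τ s * thetaVal τ (2 * s) * thetaVal τ (6 * s))) := by
  -- After this replacement the arguments s, 2s, 3s, -6s sum to zero, so the linear corrections in
  -- `zetaVal` cancel.
  have h6 : zetaVal τ (5 * s) = -zetaVal τ (6 * s) := by
    rw [← zetaVal_neg]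
    refine zetaVal_congr τ (by omega) ?_
    push_cast
    have : (11 : ZMod 11) = 0 := rfl
    linear_combination (s : ZMod 11) * this
  -- In units of sτ: a ± b = 4, 5; 2c = 3; b + c = 1, b - c = -2; a + c = 6, a - c = 3. Division by
  -- θ(1) θ(2) θ(3) θ(6) then gives the claim.
  have h := theta1_four_term (9 / 2 * (s * τ)) (-1 / 2 * (s * τ)) (3 / 2 * (s * τ))
    (eleven_mul_im_pos τ)
  have n1 := theta1_mul_ne_zero τ hs
  have n2 := theta1_mul_ne_zero τ (j := 2 * s) (by omega)
  have n3 := theta1_mul_ne_zero τ (j := 3 * s) (by omega)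
  have n6 := theta1_mul_ne_zero τ (j := 6 * s) (by omega)
  have hneg : deriv (theta1 · (11 * τ)) (-((2 * s : ℤ) * τ)) =
      deriv (theta1 · (11 * τ)) ((2 * s : ℤ) * τ) := by
    have h1 := logDeriv_theta1_neg ((2 * s : ℤ) * τ) (11 * τ)
    rw [logDeriv_apply, logDeriv_apply, theta1_neg, div_neg, neg_inj] at h1
    exact (div_left_inj' n2).mp h1
  rw [show (9 / 2 * (s * τ) + -1 / 2 * (s * τ) : ℂ) = (4 * s : ℤ) * τ by push_cast; ring,
    show (9 / 2 * (s * τ) - -1 / 2 * (s * τ) : ℂ) = (5 * s : ℤ) * τ by push_cast; ring,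
    show (2 * (3 / 2 * (s * τ)) : ℂ) = (3 * s : ℤ) * τ by push_cast; ring,
    show (-1 / 2 * (s * τ) + 3 / 2 * (s * τ) : ℂ) = s * τ by ring,
    show (-1 / 2 * (s * τ) - 3 / 2 * (s * τ) : ℂ) = -((2 * s : ℤ) * τ) by push_cast; ring,
    show (9 / 2 * (s * τ) + 3 / 2 * (s * τ) : ℂ) = (6 * s : ℤ) * τ by push_cast; ring,
    show (9 / 2 * (s * τ) - 3 / 2 * (s * τ) : ℂ) = (3 * s : ℤ) * τ by push_cast; ring,
    hneg, theta1_neg, deriv_theta1_zero (eleven_mul_im_pos τ)] at h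
  have hK : thetaVal τ (4 * s) * thetaVal τ (5 * s) /
        (thetaVal τ s * thetaVal τ (2 * s) * thetaVal τ (6 * s)) =
      theta1 ((4 * s : ℤ) * τ) (11 * τ) * theta1 ((5 * s : ℤ) * τ) (11 * τ) /
      (theta1 (s * τ) (11 * τ) * theta1 ((2 * s : ℤ) * τ) (11 * τ) *
        theta1 ((6 * s : ℤ) * τ) (11 * τ)) := by
    simp only [thetaVal]
    -- The Gaussian factors cancel because 4² + 5² = 1² + 2² + 6².
    have he : exp (Real.pi * I * ((4 * s : ℤ) : ℂ) ^ 2 * τ / 11) *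
        exp (Real.pi * I * ((5 * s : ℤ) : ℂ) ^ 2 * τ / 11) =
        exp (Real.pi * I * (s : ℂ) ^ 2 * τ / 11) *
        exp (Real.pi * I * ((2 * s : ℤ) : ℂ) ^ 2 * τ / 11) *
        exp (Real.pi * I * ((6 * s : ℤ) : ℂ) ^ 2 * τ / 11) := by
      rw [← exp_add, ← exp_add, ← exp_add]
      congr 1; push_cast; ring
    have e1 := exp_ne_zero (Real.pi * I * (s : ℂ) ^ 2 * τ / 11)
    have e2 := exp_ne_zero (Real.pi * I * ((2 * s : ℤ) : ℂ) ^ 2 * τ / 11)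
    have e6 := exp_ne_zero (Real.pi * I * ((6 * s : ℤ) : ℂ) ^ 2 * τ / 11)
    have hq : ∀ {x₄ x₅ x₁ x₂ x₆ : ℂ} (y₄ y₅ y₁ y₂ y₆ : ℂ), x₁ ≠ 0 → x₂ ≠ 0 → x₆ ≠ 0 →
        x₄ * x₅ = x₁ * x₂ * x₆ →
        x₄ * y₄ * (x₅ * y₅) / (x₁ * y₁ * (x₂ * y₂) * (x₆ * y₆)) = y₄ * y₅ / (y₁ * y₂ * y₆) := by
      intro x₄ x₅ x₁ x₂ x₆ y₄ y₅ y₁ y₂ y₆ h₁ h₂ h₆ hx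
      rw [show x₄ * y₄ * (x₅ * y₅) = x₁ * x₂ * x₆ * (y₄ * y₅) by linear_combination y₄ * y₅ * hx,
        show x₁ * y₁ * (x₂ * y₂) * (x₆ * y₆) = x₁ * x₂ * x₆ * (y₁ * y₂ * y₆) by ring,
        mul_div_mul_left _ _ (mul_ne_zero (mul_ne_zero h₁ h₂) h₆)]
    exact hq _ _ _ _ _ e1 e2 e6 he
  rw [h6, hK]
  simp only [zetaVal, logDeriv_apply]
  generalize ModularForm.eta (11 * τ) = E at *
  generalize deriv (theta1 · (11 * τ)) (s * τ) = d1 at *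
  generalize deriv (theta1 · (11 * τ)) ((2 * s : ℤ) * τ) = d2 at *
  generalize deriv (theta1 · (11 * τ)) ((3 * s : ℤ) * τ) = d3 at *
  generalize deriv (theta1 · (11 * τ)) ((6 * s : ℤ) * τ) = d6 at *
  generalize theta1 (s * τ) (11 * τ) = t1 at *
  generalize theta1 ((2 * s : ℤ) * τ) (11 * τ) = t2 at *
  generalize theta1 ((3 * s : ℤ) * τ) (11 * τ) = t3 at *
  generalize theta1 ((4 * s : ℤ) * τ) (11 * τ) = t4 at *
  generalize theta1 ((5 * s : ℤ) * τ) (11 * τ) = t5 at *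
  generalize theta1 ((6 * s : ℤ) * τ) (11 * τ) = t6 at *
  push_cast
  field_simp
  linear_combination (-11)*h

end LevelElevenValues

end LevelEleven

/-! ### The action of Γ₀(11) -/

namespace LevelEleven

open Complex
open UpperHalfPlane hiding I

section LevelElevenAction

/-- The second identity is the determinant condition; it merges the exponential or linear term of
the transformation law with the normalizations of `thetaVal` and `zetaVal`. -/
lemma mul_smul_add_one {γ : SL(2, ℤ)} (τ : ℍ) :
    ((γ • τ : ℍ) : ℂ) = ((γ 0 0 : ℤ) * τ + (γ 0 1 : ℤ)) / denom γ τ ∧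
    (γ 1 0 : ℤ) * ((γ 0 0 : ℤ) * (τ : ℂ) + (γ 0 1 : ℤ)) + 1 = (γ 0 0 : ℤ) * denom γ τ := by
  have hdet : ((γ 0 0 : ℤ) : ℂ) * (γ 1 1 : ℤ) - (γ 0 1 : ℤ) * (γ 1 0 : ℤ) = 1 := by
    have := Matrix.det_fin_two (γ : Matrix (Fin 2) (Fin 2) ℤ)
    rw [γ.det_coe] at this
    exact_mod_cast this.symm
  rw [coe_specialLinearGroup_apply, ModularGroup.denom_apply]
  refine ⟨by simp, ?_⟩
  linear_combination -hdet

/-- The transformation law of `θ(·, 11 τ)` under `Γ₀(11)`. -/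
theorem theta1_eleven_smul {γ : SL(2, ℤ)} {c : ℤ} (hc : γ 1 0 = 11 * c) (τ : ℍ) :
    ∃ C : ℂ, C ≠ 0 ∧ ∀ z, theta1 (z / denom γ τ) (11 * ((γ • τ : ℍ) : ℂ)) =
      C * exp (Real.pi * I * c * z ^ 2 / denom γ τ) * theta1 z (11 * τ) := by
  have hdet : γ 0 0 * γ 1 1 - γ 0 1 * γ 1 0 = 1 := by
    have := Matrix.det_fin_two (γ : Matrix (Fin 2) (Fin 2) ℤ)
    rw [γ.det_coe] at this
    exact this.symm
  -- Conjugation of γ by diag(11, 1); it is integral because 11 divides the lower left entry, and it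
  -- has the same automorphy factor.
  let γ' : SL(2, ℤ) := ⟨!![γ 0 0, 11 * γ 0 1; c, γ 1 1], by
    rw [Matrix.det_fin_two_of]; linear_combination hdet + γ 0 1 * hc⟩
  let τ' : ℍ := ⟨11 * τ, eleven_mul_im_pos τ⟩
  have h00 : γ' 0 0 = γ 0 0 := rfl
  have h01 : γ' 0 1 = 11 * γ 0 1 := rfl
  have h10 : γ' 1 0 = c := rfl
  have h11 : γ' 1 1 = γ 1 1 := rfl
  have hτ' : (τ' : ℂ) = 11 * τ := rfl
  have hd : denom γ' τ' = denom γ τ := by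
    rw [ModularGroup.denom_apply, ModularGroup.denom_apply, h10, h11, hc, hτ']
    push_cast
    ring
  have hs : ((γ' • τ' : ℍ) : ℂ) = 11 * ((γ • τ : ℍ) : ℂ) := by
    rw [(mul_smul_add_one τ).1, (mul_smul_add_one τ').1, hd, h00, h01, hτ']
    push_cast
    ring
  obtain ⟨C, hC, h⟩ := theta1_smul γ' τ'
  refine ⟨C, hC, fun z ↦ ?_⟩
  rw [← hs, ← hd, h, h10, hτ']

/-- The theta values are permuted by `Γ₀(11)` up to factors. -/
theorem thetaVal_smul {γ : SL(2, ℤ)} (hγ : γ ∈ CongruenceSubgroup.Gamma0 11) (τ : ℍ) :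
    ∃ C : ℂ, C ≠ 0 ∧ ∀ j : ℤ, thetaVal ((γ • τ : ℍ) : ℂ) j =
      C * ((-1) ^ (j * γ 0 1) * exp (Real.pi * I * j ^ 2 * (γ 0 0 : ℤ) * (γ 0 1 : ℤ) / 11)) *
        thetaVal τ (j * γ 0 0) := by
  obtain ⟨c, hc⟩ := (ZMod.intCast_zmod_eq_zero_iff_dvd _ 11).mp
    (CongruenceSubgroup.Gamma0_mem.mp hγ)
  obtain ⟨C, hC, h⟩ := theta1_eleven_smul hc τ
  refine ⟨C, hC, fun j ↦ ?_⟩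
  obtain ⟨hs, h1⟩ := mul_smul_add_one (γ := γ) τ
  have hd : denom γ τ ≠ 0 := denom_ne_zero _ _
  have h2 := h (j * ((γ 0 0 : ℤ) * τ + (γ 0 1 : ℤ)))
  rw [mul_div_assoc, ← hs, mul_add, ← Int.cast_mul j (γ 0 1), theta1_add_int] at h2
  rw [thetaVal, h2, thetaVal]
  have he : exp (Real.pi * I * j ^ 2 * ((γ • τ : ℍ) : ℂ) / 11) *
      exp (Real.pi * I * c * (j * ((γ 0 0 : ℤ) * τ) + (j * γ 0 1 : ℤ)) ^ 2 / denom γ τ) =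
      exp (Real.pi * I * j ^ 2 * (γ 0 0 : ℤ) * (γ 0 1 : ℤ) / 11) *
        exp (Real.pi * I * (j * γ 0 0 : ℤ) ^ 2 * τ / 11) := by
    rw [← exp_add, ← exp_add, hs]
    congr 1
    rw [hc] at h1
    push_cast at h1 ⊢
    field_simp
    linear_combination (j : ℂ) ^ 2 * ((γ 0 0 : ℤ) * τ + (γ 0 1 : ℤ)) * h1
  push_cast at he ⊢
  rw [← mul_assoc (j : ℂ)]
  rw [← mul_assoc (j : ℂ)] at he
  linear_combination C * (-1) ^ (j * γ 0 1) * theta1 (j * (γ 0 0 : ℤ) * τ) (11 * τ) * he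

/-- The zeta values are permuted by `Γ₀(11)`. -/
theorem zetaVal_smul {γ : SL(2, ℤ)} (hγ : γ ∈ CongruenceSubgroup.Gamma0 11) (τ : ℍ) {j : ℤ}
    (hj : ¬ (11 ∣ j)) :
    zetaVal ((γ • τ : ℍ) : ℂ) j = denom γ τ * zetaVal τ (j * γ 0 0) := by
  obtain ⟨c, hc⟩ := (ZMod.intCast_zmod_eq_zero_iff_dvd _ 11).mp
    (CongruenceSubgroup.Gamma0_mem.mp hγ)
  obtain ⟨C, hC, h⟩ := theta1_eleven_smul hc τ
  obtain ⟨hs, h1⟩ := mul_smul_add_one (γ := γ) τ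
  have hd : denom γ τ ≠ 0 := denom_ne_zero _ _
  set D := denom γ τ with hD
  set z₀ : ℂ := j * ((γ 0 0 : ℤ) * τ + (γ 0 1 : ℤ)) with hz₀
  have hz : z₀ / D = j * ((γ • τ : ℍ) : ℂ) := by rw [hz₀, hs, mul_div_assoc]
  have n1 : theta1 (z₀ / D) (11 * ((γ • τ : ℍ) : ℂ)) ≠ 0 := by
    rw [hz]; exact theta1_mul_ne_zero _ hj
  have n2 : theta1 z₀ (11 * τ) ≠ 0 := by
    intro h0
    rw [h, h0, mul_zero] at n1
    exact n1 rfl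
  have d1 := (differentiable_theta1 (eleven_mul_im_pos (γ • τ)) (z₀ / D)).hasDerivAt
  have d2 := (differentiable_theta1 (eleven_mul_im_pos τ) z₀).hasDerivAt
  have d3 : HasDerivAt (fun z ↦ exp (Real.pi * I * c * z ^ 2 / D))
      (exp (Real.pi * I * c * z₀ ^ 2 / D) * (Real.pi * I * c * (2 * z₀) / D)) z₀ := by
    have := (((hasDerivAt_pow 2 z₀).const_mul (Real.pi * I * c)).div_const D).cexp
    simpa using this
  have d4 := (d3.const_mul C).mul d2
  have d5 : HasDerivAt (fun z ↦ theta1 (z / D) (11 * ((γ • τ : ℍ) : ℂ)))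
      (deriv (theta1 · (11 * ((γ • τ : ℍ) : ℂ))) (z₀ / D) * (1 / D)) z₀ :=
    HasDerivAt.comp (h₂ := (theta1 · (11 * ((γ • τ : ℍ) : ℂ)))) z₀ d1
      ((hasDerivAt_id z₀).div_const D)
  -- Both sides of the transformation law are differentiated at z₀; the Gaussian contributes the
  -- inhomogeneous term 2πi c z₀.
  have d6 := d5.unique (d4.congr_of_eventuallyEq (.of_forall fun z ↦ h z))
  have hl : logDeriv (theta1 · (11 * ((γ • τ : ℍ) : ℂ))) (z₀ / D) =
      D * logDeriv (theta1 · (11 * τ)) z₀ + 2 * Real.pi * I * c * z₀ := by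
    rw [logDeriv_apply, logDeriv_apply, h z₀]
    have hE := exp_ne_zero (Real.pi * I * c * z₀ ^ 2 / D)
    generalize exp (Real.pi * I * c * z₀ ^ 2 / D) = E at *
    generalize theta1 z₀ (11 * τ) = t at *
    generalize deriv (theta1 · (11 * ((γ • τ : ℍ) : ℂ))) (z₀ / D) = x at *
    generalize deriv (theta1 · (11 * (τ : ℂ))) z₀ = y at *
    field_simp at d6 ⊢
    linear_combination d6
  rw [zetaVal, ← hz, hl, zetaVal]
  have hz1 : z₀ = (j * γ 0 0 : ℤ) * τ + (j * γ 0 1 : ℤ) := by rw [hz₀]; push_cast; ring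
  have hl2 : logDeriv (theta1 · (11 * (τ : ℂ))) z₀ =
      logDeriv (theta1 · (11 * τ)) ((j * γ 0 0 : ℤ) * τ) := by
    rw [hz1, logDeriv_theta1_add_int]
  rw [hl2, hz₀]
  rw [hc] at h1
  push_cast at h1 ⊢
  linear_combination (2 * Real.pi * I * j / 11) * h1

/-- The weight one forms `-(Z_s + Z_{2s} + Z_{3s} + Z_{5s}) / (2πi)`. -/
noncomputable def eisVal (τ : ℂ) (s : ℤ) : ℂ :=
  -(zetaVal τ s + zetaVal τ (2 * s) + zetaVal τ (3 * s) + zetaVal τ (5 * s)) / (2 * Real.pi * I)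

lemma eisVal_congr (τ : ℍ) {s t : ℤ} (hs : ¬ (11 ∣ s)) (h : (s : ZMod 11) = t) :
    eisVal τ s = eisVal τ t := by
  rw [eisVal, eisVal, zetaVal_congr τ hs h, zetaVal_congr τ (j := 2 * s) (k := 2 * t) (by omega)
    (by push_cast; rw [h]), zetaVal_congr τ (j := 3 * s) (k := 3 * t) (by omega)
    (by push_cast; rw [h]), zetaVal_congr τ (j := 5 * s) (k := 5 * t) (by omega)
    (by push_cast; rw [h])]

lemma eisVal_neg (τ : ℂ) (s : ℤ) : eisVal τ (-s) = -eisVal τ s := by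
  simp only [eisVal, mul_neg, zetaVal_neg]
  ring

lemma eisVal_smul {γ : SL(2, ℤ)} (hγ : γ ∈ CongruenceSubgroup.Gamma0 11) (τ : ℍ) {s : ℤ}
    (hs : ¬ (11 ∣ s)) :
    eisVal ((γ • τ : ℍ) : ℂ) s = denom γ τ * eisVal τ (s * γ 0 0) := by
  rw [eisVal, eisVal, zetaVal_smul hγ τ hs, zetaVal_smul hγ τ (j := 2 * s) (by omega),
    zetaVal_smul hγ τ (j := 3 * s) (by omega), zetaVal_smul hγ τ (j := 5 * s) (by omega)]
  simp only [mul_assoc]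
  ring

/-- The weight one forms as theta quotients. -/
lemma eisVal_eq (τ : ℍ) {s : ℤ} (hs : ¬ (11 ∣ s)) :
    eisVal τ s = -I * ModularForm.eta (11 * τ) ^ 3 * (thetaVal τ (4 * s) * thetaVal τ (5 * s) /
        (thetaVal τ s * thetaVal τ (2 * s) * thetaVal τ (6 * s))) := by
  rw [eisVal, zetaVal_add τ hs]
  have : (Real.pi : ℂ) ≠ 0 := by exact_mod_cast Real.pi_ne_zero
  rw [div_eq_iff (by simp [this])]
  linear_combination (2 * Real.pi * ModularForm.eta (11 * τ) ^ 3 *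
    (thetaVal τ (4 * s) * thetaVal τ (5 * s) /
        (thetaVal τ s * thetaVal τ (2 * s) * thetaVal τ (6 * s)))) * I_sq

lemma zetaVal_eq_lambert (τ : ℍ) {j : ℕ} (h0 : 0 < j) (h1 : j < 11) :
    zetaVal τ j = 2 * Real.pi * I * (j / 11 - 1 / 2) - 2 * Real.pi * I *
      (lambert (exp (2 * Real.pi * I * τ) ^ 11) (exp (2 * Real.pi * I * τ) ^ j) -
      lambert (exp (2 * Real.pi * I * τ) ^ 11) (exp (2 * Real.pi * I * τ) ^ (11 - j))) := by
  have e1 : ((j : ℤ) : ℂ) = ((j : ℝ) : ℂ) := by norm_cast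
  have e2 : (11 : ℂ) = ((11 : ℝ) : ℂ) := by norm_num
  rw [zetaVal, logDeriv_theta1]
  · rw [← exp_nat_mul, ← exp_nat_mul, ← exp_nat_mul, Nat.cast_sub h1.le]
    push_cast
    rw [show 2 * Real.pi * I * (11 * (τ : ℂ)) = 11 * (2 * Real.pi * I * τ) by ring,
      show 2 * Real.pi * I * (j * (τ : ℂ)) = j * (2 * Real.pi * I * τ) by ring,
      show 2 * Real.pi * I * (11 * (τ : ℂ) - j * τ) = (11 - j) * (2 * Real.pi * I * τ) by ring]
    ring
  · rw [e1, im_ofReal_mul]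
    exact mul_pos (by exact_mod_cast h0) τ.im_pos
  · rw [e1, e2, im_ofReal_mul, im_ofReal_mul]
    exact mul_lt_mul_of_pos_right (by exact_mod_cast h1) τ.im_pos

/-- The constant term is right because (1 + 2 + 3 + 5)/11 - 4/2 = -1, and the Lambert series at 11 -
j supply the coefficients -1 on the negative residues. -/
lemma eisSum_eleven_eq_eisVal (τ : ℍ) : eisSum 11 τ = eisVal τ 1 := by
  have z1 := zetaVal_eq_lambert τ (j := 1) (by norm_num) (by norm_num)
  have z2 := zetaVal_eq_lambert τ (j := 2) (by norm_num) (by norm_num)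
  have z3 := zetaVal_eq_lambert τ (j := 3) (by norm_num) (by norm_num)
  have z5 := zetaVal_eq_lambert τ (j := 5) (by norm_num) (by norm_num)
  have hπ : (Real.pi : ℂ) ≠ 0 := by exact_mod_cast Real.pi_ne_zero
  have c0 : eisCoeff 0 = 0 := by rw [eisCoeff]; simp +decide
  have c1 : eisCoeff 1 = 1 := by rw [eisCoeff]; simp +decide
  have c2 : eisCoeff 2 = 1 := by rw [eisCoeff]; simp +decide
  have c3 : eisCoeff 3 = 1 := by rw [eisCoeff]; simp +decide
  have c4 : eisCoeff 4 = 0 := by rw [eisCoeff]; simp +decide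
  have c5 : eisCoeff 5 = 1 := by rw [eisCoeff]; simp +decide
  have c6 : eisCoeff 6 = -1 := by rw [eisCoeff]; simp +decide
  have c7 : eisCoeff 7 = 0 := by rw [eisCoeff]; simp +decide
  have c8 : eisCoeff 8 = -1 := by rw [eisCoeff]; simp +decide
  have c9 : eisCoeff 9 = -1 := by rw [eisCoeff]; simp +decide
  have c10 : eisCoeff 10 = -1 := by rw [eisCoeff]; simp +decide
  rw [eisSum_eleven_eq, sum_zmod_eleven, c0, c1, c2, c3, c4, c5, c6, c7, c8, c9, c10, eisVal,
    show (1 : ℤ) = (1 : ℕ) from rfl, show 2 * ((1 : ℕ) : ℤ) = (2 : ℕ) from rfl,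
    show 3 * ((1 : ℕ) : ℤ) = (3 : ℕ) from rfl, show 5 * ((1 : ℕ) : ℤ) = (5 : ℕ) from rfl,
    z1, z2, z3, z5, eq_div_iff (by simp [hπ]),
    show ZMod.val (1 : ZMod 11) = 1 from rfl, show ZMod.val (2 : ZMod 11) = 2 from rfl,
    show ZMod.val (3 : ZMod 11) = 3 from rfl, show ZMod.val (5 : ZMod 11) = 5 from rfl,
    show ZMod.val (6 : ZMod 11) = 6 from rfl, show ZMod.val (8 : ZMod 11) = 8 from rfl,
    show ZMod.val (9 : ZMod 11) = 9 from rfl, show ZMod.val (10 : ZMod 11) = 10 from rfl]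
  simp only [Nat.reduceSub]
  push_cast
  ring

end LevelElevenAction

end LevelEleven

/-! ### Diamond operators -/

namespace LevelEleven

open Complex
open UpperHalfPlane hiding I

section DiamondOperators

lemma lower_right_mul_upper_left {γ : SL(2, ℤ)} (hγ : γ ∈ CongruenceSubgroup.Gamma0 11) :
    ((γ 0 0 : ℤ) : ZMod 11) * ((γ 1 1 : ℤ) : ZMod 11) = 1 := by
  have hdet := Matrix.det_fin_two (γ : Matrix (Fin 2) (Fin 2) ℤ)
  rw [γ.det_coe] at hdet
  have h := congrArg (Int.cast : ℤ → ZMod 11) hdet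
  push_cast at h
  rw [CongruenceSubgroup.Gamma0_mem.mp hγ, mul_zero, sub_zero] at h
  exact h.symm

lemma exists_mem_Gamma0_lower_right {a : ZMod 11} (ha : a ≠ 0) :
    ∃ γ : SL(2, ℤ), γ ∈ CongruenceSubgroup.Gamma0 11 ∧ ((γ 1 1 : ℤ) : ZMod 11) = a := by
  have hco : IsCoprime (11 : ℤ) (a.val : ℤ) := by
    rw [show (11 : ℤ) = ((11 : ℕ) : ℤ) from rfl, Nat.isCoprime_iff_coprime,
      Nat.Prime.coprime_iff_not_dvd (by norm_num), ← ZMod.natCast_eq_zero_iff,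
      ZMod.natCast_zmod_val]
    exact ha
  obtain ⟨γ, h0, h1⟩ := hco.exists_SL2_row 1
  refine ⟨γ, ?_, ?_⟩
  · rw [CongruenceSubgroup.Gamma0_mem, h0]; rfl
  · rw [h1]; simp

lemma not_dvd_of_mul_eq_one {s : ℤ} {a : ZMod 11} (h : (s : ZMod 11) * a = 1) : ¬ (11 ∣ s) := by
  intro hd
  have : (s : ZMod 11) = 0 := (ZMod.intCast_zmod_eq_zero_iff_dvd s 11).mpr hd
  rw [this, zero_mul] at h
  exact absurd h (by decide)

lemma eisVal_slash {γ : SL(2, ℤ)} (hγ : γ ∈ CongruenceSubgroup.Gamma0 11) {s : ℤ}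
    (hs : ¬ (11 ∣ s)) :
    (fun τ : ℍ ↦ eisVal τ s) ∣[(1 : ℤ)] γ = fun τ : ℍ ↦ eisVal τ (s * γ 0 0) := by
  funext τ
  rw [ModularForm.SL_slash_apply, eisVal_smul hγ τ hs, zpow_neg_one]
  have hd : denom γ τ ≠ 0 := denom_ne_zero _ _
  field_simp

lemma eisSum_eleven : eisSum 11 = fun τ : ℍ ↦ eisVal τ 1 := funext eisSum_eleven_eq_eisVal

/-- A matrix in `Γ₀(11)` has mutually inverse diagonal entries modulo 11, so ⟨a⟩ moves the index 1
to a⁻¹. Only the residue of the index matters, hence the chosen matrix disappears. -/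
lemma eisGen_eq_eisVal {a : ZMod 11} {s : ℤ} (h : (s : ZMod 11) * a = 1) :
    eisGen 11 a = fun τ : ℍ ↦ eisVal τ s := by
  have ha : a ≠ 0 := by
    rintro rfl
    rw [mul_zero] at h
    exact absurd h (by decide)
  have hex := exists_mem_Gamma0_lower_right ha
  rw [eisGen, diamond, dif_pos hex]
  obtain ⟨hγ, h11⟩ := hex.choose_spec
  set γ₀ := hex.choose
  rw [eisSum_eleven, eisVal_slash hγ (by norm_num), one_mul]
  funext τ
  refine (eisVal_congr τ (not_dvd_of_mul_eq_one h) ?_).symm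
  have := lower_right_mul_upper_left hγ
  rw [h11] at this
  linear_combination ((γ₀ 0 0 : ℤ) : ZMod 11) * h - (s : ZMod 11) * this

lemma eisGen_zero : eisGen 11 0 = 0 := by
  rw [eisGen, diamond, dif_neg]
  rintro ⟨γ, hγ, h⟩
  have := lower_right_mul_upper_left hγ
  rw [h, mul_zero] at this
  exact absurd this (by decide)

lemma exists_int_mul_eq_one {a : ZMod 11} (ha : a ≠ 0) : ∃ s : ℤ, (s : ZMod 11) * a = 1 := by
  have h : ∀ a : ZMod 11, a ≠ 0 → ∃ n : ZMod 11, n * a = 1 := by decide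
  obtain ⟨n, hn⟩ := h a ha
  exact ⟨n.val, by simpa using hn⟩

theorem eisSum_slash {γ : SL(2, ℤ)} (hγ : γ ∈ CongruenceSubgroup.Gamma0 11) :
    eisSum 11 ∣[(1 : ℤ)] γ = eisGen 11 ((γ 1 1 : ℤ) : ZMod 11) := by
  rw [eisSum_eleven, eisVal_slash hγ (by norm_num), one_mul,
    eisGen_eq_eisVal (lower_right_mul_upper_left hγ)]

theorem eisGen_slash {γ : SL(2, ℤ)} (hγ : γ ∈ CongruenceSubgroup.Gamma0 11) (a : ZMod 11) :
    eisGen 11 a ∣[(1 : ℤ)] γ = eisGen 11 (((γ 1 1 : ℤ) : ZMod 11) * a) := by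
  rcases eq_or_ne a 0 with rfl | ha
  · rw [mul_zero, eisGen_zero, SlashAction.zero_slash]
  · obtain ⟨s, hs⟩ := exists_int_mul_eq_one ha
    rw [eisGen_eq_eisVal hs, eisVal_slash hγ (not_dvd_of_mul_eq_one hs),
      eisGen_eq_eisVal (s := s * γ 0 0)]
    push_cast
    linear_combination (s : ZMod 11) * a * lower_right_mul_upper_left hγ + hs

lemma eisGen_neg (a : ZMod 11) (τ : ℍ) : eisGen 11 (-a) τ = -eisGen 11 a τ := by
  rcases eq_or_ne a 0 with rfl | ha
  · rw [neg_zero, eisGen_zero]; simp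
  · obtain ⟨s, hs⟩ := exists_int_mul_eq_one ha
    rw [eisGen_eq_eisVal hs, eisGen_eq_eisVal (s := -s) (by push_cast; linear_combination hs)]
    exact eisVal_neg _ _

end DiamondOperators

/-! ### Eisenstein series as theta quotients -/

section ThetaQuotients

/-- The normalized theta constants in terms of the odd theta function. -/
lemma normTheta_eleven (k : ℕ) (τ : ℍ) : normTheta 11 k τ = I * thetaVal τ (6 - k) := by
  -- The characteristic splits as (2k - 1)/22 = 1/2 + (k - 6)/11, that is, a translation by (k - 6)
  -- τ of the odd theta function.
  have h : thetaVal τ (6 - k) = -thetaVal τ (k - 6) := by rw [← thetaVal_neg, neg_sub]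
  rw [h, thetaVal, normTheta, thetaConst, theta1, thetaChar, thetaChar, ← tsum_mul_left,
    ← tsum_mul_left, ← tsum_neg, ← tsum_mul_left]
  refine tsum_congr fun n ↦ ?_
  have hI : I * -1 = exp (-(Real.pi * I / 2)) := by
    rw [exp_neg, show (Real.pi : ℂ) * I / 2 = Real.pi / 2 * I by ring, exp_pi_div_two_mul_I]
    simp
  rw [← neg_one_mul (_ * _), ← mul_assoc I, hI, ← exp_add, ← exp_add, ← exp_add]
  congr 1
  push_cast
  ring

lemma thetaVec_eq (τ : ℍ) : thetaVec τ = ![I * thetaVal τ 5, I * thetaVal τ 4,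
    I * thetaVal τ 3, I * thetaVal τ 2, I * thetaVal τ 1] := by
  funext i
  rw [thetaVec, normTheta_eleven]
  fin_cases i <;> rfl

lemma thetaVec_ne_zero (τ : ℍ) (i : Fin 5) : thetaVec τ i ≠ 0 := by
  rw [thetaVec, normTheta_eleven]
  refine mul_ne_zero I_ne_zero (thetaVal_ne_zero τ ?_)
  have := i.isLt
  push_cast
  omega

lemma thetaQuot_one (p : Fin 5 → ℂ) : thetaQuot p 1 = p 1 / (p 3 * p 4) := by
  simp [thetaQuot]

lemma thetaQuot_two (p : Fin 5 → ℂ) : thetaQuot p 2 = p 3 / (p 0 * p 4) := by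
  simp +decide [thetaQuot]

lemma thetaQuot_three (p : Fin 5 → ℂ) : thetaQuot p 3 = p 0 / (p 1 * p 2) := by
  simp +decide [thetaQuot]

lemma thetaQuot_five (p : Fin 5 → ℂ) : thetaQuot p 5 = p 2 / (p 1 * p 3) := by
  simp +decide [thetaQuot]

lemma thetaQuot_seven (p : Fin 5 → ℂ) : thetaQuot p 7 = p 4 / (p 0 * p 2) := by
  simp +decide [thetaQuot]

lemma thetaQuot_zero (p : Fin 5 → ℂ) : thetaQuot p 0 = 0 := by
  simp +decide [thetaQuot]

lemma zmod_eleven_cases (a : ZMod 11) : a = 0 ∨ a = 1 ∨ a = 2 ∨ a = 3 ∨ a = 5 ∨ a = 7 ∨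
    a = -1 ∨ a = -2 ∨ a = -3 ∨ a = -5 ∨ a = -7 := by
  revert a; decide

lemma thetaQuot_neg (p : Fin 5 → ℂ) (a : ZMod 11) : thetaQuot p (-a) = -thetaQuot p a := by
  rcases zmod_eleven_cases a with
    rfl | rfl | rfl | rfl | rfl | rfl | rfl | rfl | rfl | rfl | rfl <;>
  simp +decide [thetaQuot]

lemma thetaVal_eq_zpow_mul (τ : ℂ) (n j m : ℤ) (h : n = j + 11 * m) :
    thetaVal τ n = (-1) ^ m * thetaVal τ j := by
  rw [h, thetaVal_add_mul_eleven]

/-- The weight one forms are theta quotients. -/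
theorem eisGen_eq_thetaQuot (τ : ℍ) (a : ZMod 11) :
    eisGen 11 a τ = ModularForm.eta (11 * τ) ^ 3 * thetaQuot (thetaVec τ) a := by
  have n1 : thetaVal τ 1 ≠ 0 := thetaVal_ne_zero τ (by norm_num)
  have n2 : thetaVal τ 2 ≠ 0 := thetaVal_ne_zero τ (by norm_num)
  have n3 : thetaVal τ 3 ≠ 0 := thetaVal_ne_zero τ (by norm_num)
  have n4 : thetaVal τ 4 ≠ 0 := thetaVal_ne_zero τ (by norm_num)
  have n5 : thetaVal τ 5 ≠ 0 := thetaVal_ne_zero τ (by norm_num)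
  -- All indices are reduced to 1, …, 5. In each quotient one numerator value then cancels one
  -- denominator value, leaving one over two.
  have k6 : thetaVal τ 6 = thetaVal τ 5 := by
    rw [thetaVal_eq_zpow_mul τ 6 (-5) 1 (by norm_num), thetaVal_neg]; simp
  have k8 : thetaVal τ 8 = thetaVal τ 3 := by
    rw [thetaVal_eq_zpow_mul τ 8 (-3) 1 (by norm_num), thetaVal_neg]; simp
  have k10 : thetaVal τ 10 = thetaVal τ 1 := by
    rw [thetaVal_eq_zpow_mul τ 10 (-1) 1 (by norm_num), thetaVal_neg]; simp
  have k12 : thetaVal τ 12 = -thetaVal τ 1 := by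
    rw [thetaVal_eq_zpow_mul τ 12 1 1 (by norm_num)]; simp
  have k15 : thetaVal τ 15 = -thetaVal τ 4 := by
    rw [thetaVal_eq_zpow_mul τ 15 4 1 (by norm_num)]; simp
  have k16 : thetaVal τ 16 = -thetaVal τ 5 := by
    rw [thetaVal_eq_zpow_mul τ 16 5 1 (by norm_num)]; simp
  have k18 : thetaVal τ 18 = -thetaVal τ 4 := by
    rw [thetaVal_eq_zpow_mul τ 18 (-4) 2 (by norm_num), thetaVal_neg]; norm_num
  have k20 : thetaVal τ 20 = -thetaVal τ 2 := by
    rw [thetaVal_eq_zpow_mul τ 20 (-2) 2 (by norm_num), thetaVal_neg]; norm_num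
  have k24 : thetaVal τ 24 = thetaVal τ 2 := by
    rw [thetaVal_eq_zpow_mul τ 24 2 2 (by norm_num)]; norm_num
  have k30 : thetaVal τ 30 = thetaVal τ 3 := by
    rw [thetaVal_eq_zpow_mul τ 30 (-3) 3 (by norm_num), thetaVal_neg]
    norm_num [pow_succ]
  have k36 : thetaVal τ 36 = -thetaVal τ 3 := by
    rw [thetaVal_eq_zpow_mul τ 36 3 3 (by norm_num)]
    norm_num [pow_succ]
  have v := thetaVec_eq τ
  have v0 : thetaVec τ 0 = I * thetaVal τ 5 := by rw [v]; rfl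
  have v1 : thetaVec τ 1 = I * thetaVal τ 4 := by rw [v]; rfl
  have v2 : thetaVec τ 2 = I * thetaVal τ 3 := by rw [v]; rfl
  have v3 : thetaVec τ 3 = I * thetaVal τ 2 := by rw [v]; rfl
  have v4 : thetaVec τ 4 = I * thetaVal τ 1 := by rw [v]; rfl
  have hI := I_ne_zero
  have e1 : eisGen 11 1 τ = ModularForm.eta (11 * τ) ^ 3 * thetaQuot (thetaVec τ) 1 := by
    rw [eisGen_eq_eisVal (s := 1) (by decide), thetaQuot_one, v1, v3, v4]
    beta_reduce
    rw [eisVal_eq τ (by norm_num)]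
    norm_num [k6]
    field_simp
    linear_combination -ModularForm.eta (11 * τ) ^ 3 * I_sq
  have e2 : eisGen 11 2 τ = ModularForm.eta (11 * τ) ^ 3 * thetaQuot (thetaVec τ) 2 := by
    rw [eisGen_eq_eisVal (s := 6) (by decide), thetaQuot_two, v3, v0, v4]
    beta_reduce
    rw [eisVal_eq τ (by norm_num)]
    norm_num [k6, k12, k24, k30, k36]
    field_simp
    linear_combination -ModularForm.eta (11 * τ) ^ 3 * I_sq
  have e3 : eisGen 11 3 τ = ModularForm.eta (11 * τ) ^ 3 * thetaQuot (thetaVec τ) 3 := by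
    rw [eisGen_eq_eisVal (s := 4) (by decide), thetaQuot_three, v0, v1, v2]
    beta_reduce
    rw [eisVal_eq τ (by norm_num)]
    norm_num [k8, k16, k20, k24]
    field_simp
    linear_combination -ModularForm.eta (11 * τ) ^ 3 * I_sq
  -- The inverse of 5 is -2, so the residue -5 is treated with s = 2 and oddness is used; likewise
  -- -7 below with s = 3.
  have e5 : eisGen 11 5 τ = ModularForm.eta (11 * τ) ^ 3 * thetaQuot (thetaVec τ) 5 := by
    rw [← neg_inj, ← eisGen_neg, eisGen_eq_eisVal (s := 2) (by decide), thetaQuot_five, v2, v1, v3]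
    beta_reduce
    rw [eisVal_eq τ (by norm_num)]
    norm_num [k8, k10, k12]
    field_simp
    linear_combination -ModularForm.eta (11 * τ) ^ 3 * I_sq
  have e7 : eisGen 11 7 τ = ModularForm.eta (11 * τ) ^ 3 * thetaQuot (thetaVec τ) 7 := by
    rw [← neg_inj, ← eisGen_neg, eisGen_eq_eisVal (s := 3) (by decide), thetaQuot_seven, v4, v0, v2]
    beta_reduce
    rw [eisVal_eq τ (by norm_num)]
    norm_num [k6, k12, k15, k18]
    field_simp
    linear_combination -ModularForm.eta (11 * τ) ^ 3 * I_sq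
  rcases zmod_eleven_cases a with
    rfl | rfl | rfl | rfl | rfl | rfl | rfl | rfl | rfl | rfl | rfl
  · rw [eisGen_zero, thetaQuot_zero, mul_zero]; rfl
  · exact e1
  · exact e2
  · exact e3
  · exact e5
  · exact e7
  · rw [eisGen_neg, thetaQuot_neg, e1, mul_neg]
  · rw [eisGen_neg, thetaQuot_neg, e2, mul_neg]
  · rw [eisGen_neg, thetaQuot_neg, e3, mul_neg]
  · rw [eisGen_neg, thetaQuot_neg, e5, mul_neg]
  · rw [eisGen_neg, thetaQuot_neg, e7, mul_neg]

end ThetaQuotients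

end LevelEleven

/-! ### Klein's matrix and its minors -/

namespace LevelEleven

open Complex
open UpperHalfPlane hiding I

section KleinMatrix

lemma det_fin_four {R : Type*} [CommRing R] (A : Matrix (Fin 4) (Fin 4) R) : A.det =
    A 0 0 * (A 1 1 * (A 2 2 * A 3 3 - A 2 3 * A 3 2) - A 1 2 * (A 2 1 * A 3 3 - A 2 3 * A 3 1) +
      A 1 3 * (A 2 1 * A 3 2 - A 2 2 * A 3 1)) -
    A 0 1 * (A 1 0 * (A 2 2 * A 3 3 - A 2 3 * A 3 2) - A 1 2 * (A 2 0 * A 3 3 - A 2 3 * A 3 0) +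
      A 1 3 * (A 2 0 * A 3 2 - A 2 2 * A 3 0)) +
    A 0 2 * (A 1 0 * (A 2 1 * A 3 3 - A 2 3 * A 3 1) - A 1 1 * (A 2 0 * A 3 3 - A 2 3 * A 3 0) +
      A 1 3 * (A 2 0 * A 3 1 - A 2 1 * A 3 0)) -
    A 0 3 * (A 1 0 * (A 2 1 * A 3 2 - A 2 2 * A 3 1) - A 1 1 * (A 2 0 * A 3 2 - A 2 2 * A 3 0) +
      A 1 2 * (A 2 0 * A 3 1 - A 2 1 * A 3 0)) := by
  rw [Matrix.det_succ_row_zero]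
  simp [Fin.sum_univ_succ, Matrix.det_fin_three, Fin.succAbove]
  ring

/-- This and the nine lemmas that follow account for all ten off-diagonal positions of the symmetric
matrix: the residues 1, …, 5 represent all units up to sign, and the two forms are even in the
residue. -/
lemma mul_relOne_thetaQuot_one {p : Fin 5 → ℂ} (hp : ∀ i, p i ≠ 0) :
    p 0 * p 1 ^ 2 * p 2 ^ 2 * p 3 * relOne (thetaQuot p) 1 =
      kleinMinor 0 1 (kleinPoint p) := by
  have h0 := hp 0
  have h1 := hp 1
  have h2 := hp 2
  have h3 := hp 3
  have h4 := hp 4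
  rw [relOne, kleinMinor, det_fin_four]
  simp +decide only [thetaQuot, ↓reduceIte]
  simp [kleinMatrix, kleinPoint, Fin.succAbove]
  field_simp
  ring

lemma mul_relOne_thetaQuot_two {p : Fin 5 → ℂ} (hp : ∀ i, p i ≠ 0) :
    p 1 ^ 2 * p 2 * p 3 ^ 2 * p 4 * relOne (thetaQuot p) 2 =
      kleinMinor 3 4 (kleinPoint p) := by
  have h0 := hp 0
  have h1 := hp 1
  have h2 := hp 2
  have h3 := hp 3
  have h4 := hp 4
  rw [relOne, kleinMinor, det_fin_four]
  simp +decide only [thetaQuot, ↓reduceIte]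
  simp [kleinMatrix, kleinPoint, Fin.succAbove]
  field_simp
  ring

lemma mul_relOne_thetaQuot_three {p : Fin 5 → ℂ} (hp : ∀ i, p i ≠ 0) :
    p 0 ^ 2 * p 2 * p 3 * p 4 ^ 2 * relOne (thetaQuot p) 3 =
      -kleinMinor 0 4 (kleinPoint p) := by
  have h0 := hp 0
  have h1 := hp 1
  have h2 := hp 2
  have h3 := hp 3
  have h4 := hp 4
  rw [relOne, kleinMinor, det_fin_four]
  simp +decide only [thetaQuot, ↓reduceIte]
  simp [kleinMatrix, kleinPoint, Fin.succAbove]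
  field_simp
  ring

lemma mul_relOne_thetaQuot_four {p : Fin 5 → ℂ} (hp : ∀ i, p i ≠ 0) :
    p 0 * p 1 * p 3 ^ 2 * p 4 ^ 2 * relOne (thetaQuot p) 4 =
      -kleinMinor 1 2 (kleinPoint p) := by
  have h0 := hp 0
  have h1 := hp 1
  have h2 := hp 2
  have h3 := hp 3
  have h4 := hp 4
  rw [relOne, kleinMinor, det_fin_four]
  simp +decide only [thetaQuot, ↓reduceIte]
  simp [kleinMatrix, kleinPoint, Fin.succAbove]
  field_simp
  ring

lemma mul_relOne_thetaQuot_five {p : Fin 5 → ℂ} (hp : ∀ i, p i ≠ 0) :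
    p 0 ^ 2 * p 1 * p 2 ^ 2 * p 4 * relOne (thetaQuot p) 5 =
      -kleinMinor 2 3 (kleinPoint p) := by
  have h0 := hp 0
  have h1 := hp 1
  have h2 := hp 2
  have h3 := hp 3
  have h4 := hp 4
  rw [relOne, kleinMinor, det_fin_four]
  simp +decide only [thetaQuot, ↓reduceIte]
  simp [kleinMatrix, kleinPoint, Fin.succAbove]
  field_simp
  ring

lemma mul_relTwo_thetaQuot_one {p : Fin 5 → ℂ} (hp : ∀ i, p i ≠ 0) :
    p 0 * p 1 * p 2 * p 3 ^ 2 * p 4 * relTwo (thetaQuot p) 1 =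
      -kleinMinor 2 4 (kleinPoint p) := by
  have h0 := hp 0
  have h1 := hp 1
  have h2 := hp 2
  have h3 := hp 3
  have h4 := hp 4
  rw [relTwo, kleinMinor, det_fin_four]
  simp +decide only [thetaQuot, ↓reduceIte]
  simp [kleinMatrix, kleinPoint, Fin.succAbove]
  field_simp
  ring

lemma mul_relTwo_thetaQuot_two {p : Fin 5 → ℂ} (hp : ∀ i, p i ≠ 0) :
    p 0 * p 1 * p 2 * p 3 * p 4 ^ 2 * relTwo (thetaQuot p) 2 =
      -kleinMinor 0 2 (kleinPoint p) := by
  have h0 := hp 0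
  have h1 := hp 1
  have h2 := hp 2
  have h3 := hp 3
  have h4 := hp 4
  rw [relTwo, kleinMinor, det_fin_four]
  simp +decide only [thetaQuot, ↓reduceIte]
  simp [kleinMatrix, kleinPoint, Fin.succAbove]
  field_simp
  ring

lemma mul_relTwo_thetaQuot_three {p : Fin 5 → ℂ} (hp : ∀ i, p i ≠ 0) :
    p 0 * p 1 * p 2 ^ 2 * p 3 * p 4 * relTwo (thetaQuot p) 3 =
      -kleinMinor 1 3 (kleinPoint p) := by
  have h0 := hp 0
  have h1 := hp 1
  have h2 := hp 2
  have h3 := hp 3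
  have h4 := hp 4
  rw [relTwo, kleinMinor, det_fin_four]
  simp +decide only [thetaQuot, ↓reduceIte]
  simp [kleinMatrix, kleinPoint, Fin.succAbove]
  field_simp
  ring

lemma mul_relTwo_thetaQuot_four {p : Fin 5 → ℂ} (hp : ∀ i, p i ≠ 0) :
    p 0 ^ 2 * p 1 * p 2 * p 3 * p 4 * relTwo (thetaQuot p) 4 =
      kleinMinor 0 3 (kleinPoint p) := by
  have h0 := hp 0
  have h1 := hp 1
  have h2 := hp 2
  have h3 := hp 3
  have h4 := hp 4
  rw [relTwo, kleinMinor, det_fin_four]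
  simp +decide only [thetaQuot, ↓reduceIte]
  simp [kleinMatrix, kleinPoint, Fin.succAbove]
  field_simp
  ring

lemma mul_relTwo_thetaQuot_five {p : Fin 5 → ℂ} (hp : ∀ i, p i ≠ 0) :
    p 0 * p 1 ^ 2 * p 2 * p 3 * p 4 * relTwo (thetaQuot p) 5 =
      -kleinMinor 1 4 (kleinPoint p) := by
  have h0 := hp 0
  have h1 := hp 1
  have h2 := hp 2
  have h3 := hp 3
  have h4 := hp 4
  rw [relTwo, kleinMinor, det_fin_four]
  simp +decide only [thetaQuot, ↓reduceIte]
  simp [kleinMatrix, kleinPoint, Fin.succAbove]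
  field_simp
  ring

/-- A cyclic shift of the coordinates permutes rows and columns of Klein's matrix by the same shift.
-/
lemma kleinMinor_shift (u : Fin 5 → ℂ) :
    kleinMinor 0 2 (fun i ↦ u (i + 2)) = kleinMinor 2 4 u := by
  rw [kleinMinor, kleinMinor, det_fin_four, det_fin_four]
  simp [kleinMatrix, Fin.succAbove]
  ring

lemma kleinMinor_eq_zero_of_rank {u : Fin 5 → ℂ} (h : (kleinMatrix u).rank = 3) (i j : Fin 5) :
    kleinMinor i j u = 0 := by
  by_contra hne
  have h1 := Matrix.rank_of_isUnit _
    ((Matrix.isUnit_iff_isUnit_det _).mpr (isUnit_iff_ne_zero.mpr hne))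
  have h2 := (kleinMatrix u).rank_submatrix_le i.succAbove j.succAbove
  rw [h1, h, Fintype.card_fin] at h2
  omega

/-- Where the coordinates do not vanish, four of the minors of Klein's matrix suffice. -/
theorem rank_kleinMatrix_eq_three {u : Fin 5 → ℂ} (h0 : u 0 ≠ 0) (h2 : u 2 ≠ 0) (h3 : u 3 ≠ 0)
    (m01 : kleinMinor 0 1 u = 0) (m02 : kleinMinor 0 2 u = 0) (m14 : kleinMinor 1 4 u = 0)
    (m24 : kleinMinor 2 4 u = 0) : (kleinMatrix u).rank = 3 := by
  refine le_antisymm ?_ ?_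
  -- Rows 0 and 4 are combinations of rows 1, 2, 3. The coefficients are forced by columns 0, 3, 4,
  -- where rows 1, 2, 3 form an invertible block.
  · have hf : kleinMatrix u =
        !![u 1 / u 0, -u 4 ^ 2 / (u 2 * u 3), u 4 / u 3;
          1, 0, 0;
          0, 1, 0;
          0, 0, 1;
          u 4 / u 0, (u 3 - u 0 * u 4 / u 3) / u 2, u 0 / u 3] *
        (kleinMatrix u).submatrix ![1, 2, 3] id := by
      rw [kleinMinor, det_fin_four] at m01 m02 m14 m24
      simp [kleinMatrix, Fin.succAbove] at m01 m02 m14 m24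
      ext i j
      rw [Matrix.mul_apply, Fin.sum_univ_three]
      fin_cases i <;> fin_cases j <;> simp [kleinMatrix] <;> field_simp
      all_goals try ring1
      -- The entries left are rows 0 and 4 in columns 1 and 2. By symmetry of the matrix each is one
      -- of the four minors.
      · linear_combination -m24
      · linear_combination -m14
      · linear_combination m02
      · linear_combination m01
    rw [hf]
    refine (Matrix.rank_mul_le_left _ _).trans (Matrix.rank_le_width _)
  -- The lower bound comes from the same block, a triangular one with determinant u 0 * u 2 * u 3.
  · have hne : ((kleinMatrix u).submatrix ![1, 2, 3] ![0, 3, 4]).det ≠ 0 := by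
      rw [Matrix.det_fin_three]
      simp [kleinMatrix, h0, h2, h3]
    have h1 := Matrix.rank_of_isUnit _
      ((Matrix.isUnit_iff_isUnit_det _).mpr (isUnit_iff_ne_zero.mpr hne))
    have h2 := (kleinMatrix u).rank_submatrix_le ![1, 2, 3] ![0, 3, 4]
    rw [h1, Fintype.card_fin] at h2
    exact h2

lemma relOne_thetaQuot_neg (p : Fin 5 → ℂ) (a : ZMod 11) :
    relOne (thetaQuot p) (-a) = relOne (thetaQuot p) a := by
  simp only [relOne, mul_neg, thetaQuot_neg]
  ring

lemma relTwo_thetaQuot_neg (p : Fin 5 → ℂ) (a : ZMod 11) :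
    relTwo (thetaQuot p) (-a) = relTwo (thetaQuot p) a := by
  simp only [relTwo, mul_neg, thetaQuot_neg]
  ring

lemma zmod_eleven_cases_neg (a : ZMod 11) : a = 0 ∨ a = 1 ∨ a = 2 ∨ a = 3 ∨ a = 4 ∨ a = 5 ∨
    a = -1 ∨ a = -2 ∨ a = -3 ∨ a = -4 ∨ a = -5 := by
  revert a; decide

lemma relations_of_rank {p : Fin 5 → ℂ} (hp : ∀ i, p i ≠ 0)
    (h : (kleinMatrix (kleinPoint p)).rank = 3) (a : ZMod 11) :
    relOne (thetaQuot p) a = 0 ∧ relTwo (thetaQuot p) a = 0 := by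
  have h0 := hp 0
  have h1 := hp 1
  have h2 := hp 2
  have h3 := hp 3
  have h4 := hp 4
  have o1 := mul_relOne_thetaQuot_one hp
  have o2 := mul_relOne_thetaQuot_two hp
  have o3 := mul_relOne_thetaQuot_three hp
  have o4 := mul_relOne_thetaQuot_four hp
  have o5 := mul_relOne_thetaQuot_five hp
  have t1 := mul_relTwo_thetaQuot_one hp
  have t2 := mul_relTwo_thetaQuot_two hp
  have t3 := mul_relTwo_thetaQuot_three hp
  have t4 := mul_relTwo_thetaQuot_four hp
  have t5 := mul_relTwo_thetaQuot_five hp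
  simp only [kleinMinor_eq_zero_of_rank h, neg_zero, mul_eq_zero, pow_eq_zero_iff, ne_eq,
    OfNat.ofNat_ne_zero, not_false_eq_true, h0, h1, h2, h3, h4, false_or] at o1 o2 o3 o4 o5
  simp only [kleinMinor_eq_zero_of_rank h, neg_zero, mul_eq_zero, pow_eq_zero_iff, ne_eq,
    OfNat.ofNat_ne_zero, not_false_eq_true, h0, h1, h2, h3, h4, false_or] at t1 t2 t3 t4 t5
  rcases zmod_eleven_cases_neg a with
    rfl | rfl | rfl | rfl | rfl | rfl | rfl | rfl | rfl | rfl | rfl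
  · simp [relOne, relTwo, thetaQuot_zero]
  · exact ⟨o1, t1⟩
  · exact ⟨o2, t2⟩
  · exact ⟨o3, t3⟩
  · exact ⟨o4, t4⟩
  · exact ⟨o5, t5⟩
  all_goals rw [relOne_thetaQuot_neg, relTwo_thetaQuot_neg]
  · exact ⟨o1, t1⟩
  · exact ⟨o2, t2⟩
  · exact ⟨o3, t3⟩
  · exact ⟨o4, t4⟩
  · exact ⟨o5, t5⟩

lemma rank_of_minors {p : Fin 5 → ℂ} (hp : ∀ i, p i ≠ 0)
    (m01 : kleinMinor 0 1 (kleinPoint p) = 0) (m02 : kleinMinor 0 2 (kleinPoint p) = 0)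
    (m14 : kleinMinor 1 4 (kleinPoint p) = 0) (m24 : kleinMinor 2 4 (kleinPoint p) = 0) :
    (kleinMatrix (kleinPoint p)).rank = 3 :=
  rank_kleinMatrix_eq_three (hp 2) (hp 0) (neg_ne_zero.mpr (hp 1)) m01 m02 m14 m24

/-- The relations between the theta quotients are the equations of Klein's curve. -/
theorem relations_iff_rank {p : Fin 5 → ℂ} (hp : ∀ i, p i ≠ 0) :
    (∀ a : ZMod 11, a ≠ 0 → relOne (thetaQuot p) a = 0 ∧ relTwo (thetaQuot p) a = 0) ↔
      (kleinMatrix (kleinPoint p)).rank = 3 := by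
  refine ⟨fun h ↦ ?_, fun h a _ ↦ relations_of_rank hp h a⟩
  have o1 := mul_relOne_thetaQuot_one hp
  have t1 := mul_relTwo_thetaQuot_one hp
  have t2 := mul_relTwo_thetaQuot_two hp
  have t5 := mul_relTwo_thetaQuot_five hp
  rw [(h 1 (by decide)).1, mul_zero] at o1
  rw [(h 1 (by decide)).2, mul_zero] at t1
  rw [(h 2 (by decide)).2, mul_zero] at t2
  rw [(h 5 (by decide)).2, mul_zero] at t5
  exact rank_of_minors hp o1.symm (neg_eq_zero.mp t2.symm) (neg_eq_zero.mp t5.symm)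
    (neg_eq_zero.mp t1.symm)

lemma kleinMatrix_smul (c : ℂ) (u : Fin 5 → ℂ) : kleinMatrix (c • u) = c • kleinMatrix u := by
  ext i j
  fin_cases i <;> fin_cases j <;> simp [kleinMatrix]

lemma rank_kleinMatrix_smul {c : ℂ} (hc : c ≠ 0) (u : Fin 5 → ℂ) :
    (kleinMatrix (c • u)).rank = (kleinMatrix u).rank := by
  rw [kleinMatrix_smul,
    Matrix.rank_smul_of_mem_nonZeroDivisors _ (mem_nonZeroDivisors_of_ne_zero hc)]

lemma mk_mem_kleinLocus {u : Fin 5 → ℂ} (hu : u ≠ 0) :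
    Projectivization.mk ℂ u hu ∈ kleinLocus ↔ (kleinMatrix u).rank = 3 := by
  obtain ⟨c, hc⟩ := Projectivization.exists_smul_eq_mk_rep ℂ u hu
  rw [kleinLocus, Set.mem_ofPred_eq, ← hc, Units.smul_def, rank_kleinMatrix_smul c.ne_zero]

end KleinMatrix

end LevelEleven

/-! ### The map from the modular curve to Klein's curve -/

namespace LevelEleven

open Complex
open UpperHalfPlane hiding I

section ThetaMap

/-- The theta constants map the upper half plane to Klein's curve. -/
theorem rank_kleinMatrix_thetaVec (τ : ℍ) :
    (kleinMatrix (kleinPoint (thetaVec τ))).rank = 3 := by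
  have n1 : thetaVal τ 1 ≠ 0 := thetaVal_ne_zero τ (by norm_num)
  have kneg : ∀ n, thetaVal τ (-n) = -thetaVal τ n := thetaVal_neg τ
  have k6 : thetaVal τ 6 = thetaVal τ 5 := by
    rw [thetaVal_eq_zpow_mul τ 6 (-5) 1 (by norm_num), thetaVal_neg]; simp
  have k7 : thetaVal τ 7 = thetaVal τ 4 := by
    rw [thetaVal_eq_zpow_mul τ 7 (-4) 1 (by norm_num), thetaVal_neg]; simp
  have k8 : thetaVal τ 8 = thetaVal τ 3 := by
    rw [thetaVal_eq_zpow_mul τ 8 (-3) 1 (by norm_num), thetaVal_neg]; simp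
  have k9 : thetaVal τ 9 = thetaVal τ 2 := by
    rw [thetaVal_eq_zpow_mul τ 9 (-2) 1 (by norm_num), thetaVal_neg]; simp
  -- With a = 0 the factors pair up as t_b t_{-b} = -t_b², giving quartic relations between t_1, …,
  -- t_5.
  have s124 := thetaVal_three_term τ 0 1 2 4
  have s125 := thetaVal_three_term τ 0 1 2 5
  have s135 := thetaVal_three_term τ 0 1 3 5
  have s345 := thetaVal_three_term τ 0 3 4 5
  norm_num [kneg, k6, k7, k8, k9] at s124 s125 s135 s345
  have v := thetaVec_eq τ
  have v0 : thetaVec τ 0 = I * thetaVal τ 5 := by rw [v]; rfl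
  have v1 : thetaVec τ 1 = I * thetaVal τ 4 := by rw [v]; rfl
  have v2 : thetaVec τ 2 = I * thetaVal τ 3 := by rw [v]; rfl
  have v3 : thetaVec τ 3 = I * thetaVal τ 2 := by rw [v]; rfl
  have v4 : thetaVec τ 4 = I * thetaVal τ 1 := by rw [v]; rfl
  refine rank_of_minors (thetaVec_ne_zero τ) ?_ ?_ ?_ ?_ <;> rw [kleinMinor, det_fin_four] <;>
    simp [kleinMatrix, kleinPoint, Fin.succAbove, v0, v1, v2, v3, v4]
  -- Only this minor is not itself a three-term relation: in the combination below t_2² t_3 t_4 t_5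
  -- cancels and t_1 factors out.
  · refine mul_left_cancel₀ n1 ?_
    linear_combination I ^ 4 * (thetaVal τ 4 * s124 - thetaVal τ 3 * s125)
  · linear_combination I ^ 4 * s345
  · linear_combination I ^ 4 * s125
  · linear_combination -I ^ 4 * s135

theorem thetaVec_smul {γ : SL(2, ℤ)} (hγ : γ ∈ CongruenceSubgroup.Gamma 11) (τ : ℍ) :
    ∃ C : ℂ, C ≠ 0 ∧ thetaVec (γ • τ) = C • thetaVec τ := by
  obtain ⟨h00, h01, h10, -⟩ := CongruenceSubgroup.Gamma_mem.mp hγ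
  obtain ⟨C, hC, h⟩ := thetaVal_smul (CongruenceSubgroup.Gamma0_mem.mpr h10) τ
  obtain ⟨b, hb⟩ := (ZMod.intCast_zmod_eq_zero_iff_dvd _ 11).mp h01
  obtain ⟨m, hm⟩ := (ZMod.intCast_eq_intCast_iff_dvd_sub 1 (γ 0 0) 11).mp (by simp [h00])
  have hdet : γ 0 0 * γ 1 1 - γ 0 1 * γ 1 0 = 1 := by
    have := Matrix.det_fin_two (γ : Matrix (Fin 2) (Fin 2) ℤ)
    rw [γ.det_coe] at this
    exact this.symm
  have ha : γ 0 0 = 1 + 11 * m := by push_cast at hm; linarith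
  have hb' : γ 0 1 = 11 * b := hb
  -- If m is odd then the upper left entry 1 + 11m is even, so determinant 1 forces 11b, hence b, to
  -- be odd.
  have heven : Even (m * (b + 1)) := by
    rcases Int.even_or_odd m with hm2 | hm2
    · exact hm2.mul_right _
    rcases Int.even_or_odd b with hb2 | hb2
    · exfalso
      have h1 : Even (γ 0 0) := by rw [ha]; grind
      have h2 : Even (γ 0 1) := by rw [hb']; grind
      have h3 := (h1.mul_right (γ 1 1)).sub (h2.mul_right (γ 1 0))
      rw [hdet] at h3
      exact absurd h3 (by decide)
    · exact (hb2.add_one).mul_left _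
  have key : ∀ j : ℤ, thetaVal ((γ • τ : ℍ) : ℂ) j = C * thetaVal τ j := by
    intro j
    have he : exp (Real.pi * I * j ^ 2 * (γ 0 0 : ℤ) * (γ 0 1 : ℤ) / 11) =
        (-1) ^ (j ^ 2 * γ 0 0 * b) := by
      rw [← exp_pi_mul_I, ← exp_int_mul, hb']
      congr 1
      push_cast
      ring
    have hj : j * γ 0 0 = j + 11 * (j * m) := by rw [ha]; ring
    rw [h, hj, thetaVal_add_mul_eleven, he]
    -- The three signs from `thetaVal_smul` and from reducing the index cancel for every j, which
    -- leaves the single constant C.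
    have hs : ((-1 : ℂ) ^ (j * γ 0 1) * (-1) ^ (j ^ 2 * γ 0 0 * b)) * (-1) ^ (j * m) = 1 := by
      rw [← zpow_add₀ (by norm_num), ← zpow_add₀ (by norm_num)]
      refine Even.neg_one_zpow ?_
      have hjj : Even (j * (j - 1)) := Int.even_mul_pred_self j
      have : j * γ 0 1 + j ^ 2 * γ 0 0 * b + j * m =
          j * (m * (b + 1)) + (j * (j - 1)) * (γ 0 0 * b) + 2 * (j * b * (6 + 5 * m)) := by
        rw [ha, hb']; ring
      rw [this]
      exact ((heven.mul_left j).add (hjj.mul_right _)).add (even_two_mul _)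
    linear_combination C * thetaVal τ j * hs
  refine ⟨C, hC, ?_⟩
  rw [thetaVec_eq, thetaVec_eq]
  simp only [key]
  funext i
  fin_cases i <;> simp <;> ring

lemma kleinPoint_smul (c : ℂ) (p : Fin 5 → ℂ) : kleinPoint (c • p) = c • kleinPoint p := by
  funext i
  fin_cases i <;> simp [kleinPoint]

lemma kleinPoint_thetaVec_ne_zero (τ : ℍ) : kleinPoint (thetaVec τ) ≠ 0 := fun h ↦
  thetaVec_ne_zero τ 2 (congrFun h 0)

/-- The map from the modular curve of level `Γ(11)` to Klein's curve. -/
noncomputable def thetaMap :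
    MulAction.orbitRel.Quotient (CongruenceSubgroup.Gamma 11) ℍ →
      Projectivization ℂ (Fin 5 → ℂ) :=
  Quotient.lift (fun τ ↦ Projectivization.mk ℂ (kleinPoint (thetaVec τ))
    (kleinPoint_thetaVec_ne_zero τ)) (by
      rintro τ₁ τ₂ ⟨γ, rfl⟩
      obtain ⟨C, hC, h⟩ := thetaVec_smul γ.2 τ₂
      rw [Projectivization.mk_eq_mk_iff']
      exact ⟨C, by rw [← kleinPoint_smul, ← h]; rfl⟩)

lemma thetaMap_mem_kleinLocus (x : MulAction.orbitRel.Quotient (CongruenceSubgroup.Gamma 11) ℍ) :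
    thetaMap x ∈ kleinLocus := by
  induction x using Quotient.inductionOn with
  | h τ => exact (mk_mem_kleinLocus _).mpr (rank_kleinMatrix_thetaVec τ)

/-- Both forms are homogeneous of degree two, so the common factor η(11τ)³ comes out squared. -/
lemma relations_eisGen (a : ZMod 11) (τ : ℍ) :
    relOne (fun b ↦ eisGen 11 b τ) a = 0 ∧ relTwo (fun b ↦ eisGen 11 b τ) a = 0 := by
  obtain ⟨h1, h2⟩ := relations_of_rank (thetaVec_ne_zero τ) (rank_kleinMatrix_thetaVec τ) a
  rw [relOne] at h1 ⊢
  rw [relTwo] at h2 ⊢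
  simp only [eisGen_eq_thetaQuot]
  exact ⟨by linear_combination (ModularForm.eta (11 * τ) ^ 3) ^ 2 * h1,
    by linear_combination (ModularForm.eta (11 * τ) ^ 3) ^ 2 * h2⟩

end ThetaMap

end LevelEleven

theorem mainTheorem11 :
    -- the two quadratic relations
    (∀ τ : ℍ,
      LevelEleven.eisGen 11 3 τ * LevelEleven.eisGen 11 7 τ
          + LevelEleven.eisGen 11 1 τ * LevelEleven.eisGen 11 7 τ
          - LevelEleven.eisGen 11 3 τ * LevelEleven.eisGen 11 5 τ
          - LevelEleven.eisGen 11 5 τ * LevelEleven.eisGen 11 7 τ = 0 ∧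
      LevelEleven.eisGen 11 1 τ * LevelEleven.eisGen 11 3 τ
          - LevelEleven.eisGen 11 1 τ * LevelEleven.eisGen 11 5 τ
          + LevelEleven.eisGen 11 5 τ * LevelEleven.eisGen 11 7 τ = 0) ∧
    -- the action of `Γ₀(11)` on the generators
    (∀ γ : SL(2, ℤ), γ ∈ CongruenceSubgroup.Gamma0 11 →
      LevelEleven.eisSum 11 ∣[(1 : ℤ)] γ = LevelEleven.eisGen 11 ((γ 1 1 : ℤ) : ZMod 11) ∧
      ∀ a : ZMod 11, LevelEleven.eisGen 11 a ∣[(1 : ℤ)] γ =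
        LevelEleven.eisGen 11 (((γ 1 1 : ℤ) : ZMod 11) * a)) ∧
    -- the images of the two relations under this action
    (∀ (a : ZMod 11) (τ : ℍ),
      LevelEleven.relOne (fun b => LevelEleven.eisGen 11 b τ) a = 0 ∧
      LevelEleven.relTwo (fun b => LevelEleven.eisGen 11 b τ) a = 0) ∧
    -- the theta quotient representation
    (∀ τ : ℍ, (∀ i, LevelEleven.thetaVec τ i ≠ 0) ∧
      ∀ a : ZMod 11, LevelEleven.eisGen 11 a τ =
        ModularForm.eta (11 * (τ : ℂ)) ^ 3 *
          LevelEleven.thetaQuot (LevelEleven.thetaVec τ) a) ∧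
    -- in terms of theta quotients, the relations are minors of Klein's matrix, and together with
    -- their images they are the equations of the locus where it has rank three
    (∀ p : Fin 5 → ℂ, (∀ i, p i ≠ 0) →
      p 0 * p 1 ^ 2 * p 2 ^ 2 * p 3 * LevelEleven.relOne (LevelEleven.thetaQuot p) 1 =
        LevelEleven.kleinMinor 0 1 (LevelEleven.kleinPoint p) ∧
      p 0 * p 1 * p 2 * p 3 ^ 2 * p 4 * LevelEleven.relTwo (LevelEleven.thetaQuot p) 1 =
        -LevelEleven.kleinMinor 0 2 (fun i => LevelEleven.kleinPoint p (i + 2)) ∧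
      p 0 * p 1 * p 2 * p 3 * p 4 ^ 2 * LevelEleven.relTwo (LevelEleven.thetaQuot p) 2 =
        -LevelEleven.kleinMinor 0 2 (LevelEleven.kleinPoint p) ∧
      ((∀ a : ZMod 11, a ≠ 0 → LevelEleven.relOne (LevelEleven.thetaQuot p) a = 0 ∧
          LevelEleven.relTwo (LevelEleven.thetaQuot p) a = 0) ↔
        (LevelEleven.kleinMatrix (LevelEleven.kleinPoint p)).rank = 3)) ∧
    -- the resulting theta constant identities
    (∀ τ : ℍ,
      LevelEleven.normTheta 11 3 τ * LevelEleven.normTheta 11 2 τ ^ 3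
          - LevelEleven.normTheta 11 3 τ ^ 2 * LevelEleven.normTheta 11 5 τ *
              LevelEleven.normTheta 11 2 τ
          + LevelEleven.normTheta 11 1 τ * LevelEleven.normTheta 11 4 τ *
              LevelEleven.normTheta 11 5 τ * LevelEleven.normTheta 11 2 τ
          - LevelEleven.normTheta 11 1 τ ^ 2 * LevelEleven.normTheta 11 3 τ ^ 2 = 0 ∧
      LevelEleven.normTheta 11 2 τ * LevelEleven.normTheta 11 4 τ *
              LevelEleven.normTheta 11 1 τ ^ 2
          - LevelEleven.normTheta 11 1 τ * LevelEleven.normTheta 11 2 τ *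
              LevelEleven.normTheta 11 3 τ ^ 2
          + LevelEleven.normTheta 11 3 τ * LevelEleven.normTheta 11 4 τ *
              LevelEleven.normTheta 11 5 τ ^ 2 = 0 ∧
      LevelEleven.kleinMinor 0 1 (LevelEleven.kleinPoint (LevelEleven.thetaVec τ)) = 0 ∧
      LevelEleven.kleinMinor 0 2 (LevelEleven.kleinPoint (LevelEleven.thetaVec τ)) = 0) ∧
    -- the theta constants map `Γ(11) \ ℍ` to the locus
    (∃ Φ : MulAction.orbitRel.Quotient (CongruenceSubgroup.Gamma 11) ℍ →
        Projectivization ℂ (Fin 5 → ℂ),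
      (∀ τ : ℍ, ∃ h : LevelEleven.kleinPoint (LevelEleven.thetaVec τ) ≠ 0,
        Φ (Quotient.mk _ τ) =
          Projectivization.mk ℂ (LevelEleven.kleinPoint (LevelEleven.thetaVec τ)) h) ∧
      ∀ x, Φ x ∈ LevelEleven.kleinLocus) := by
  open LevelEleven in
  refine ⟨fun τ ↦ ?_, fun γ hγ ↦ ⟨eisSum_slash hγ, eisGen_slash hγ⟩, relations_eisGen,
    fun τ ↦ ⟨thetaVec_ne_zero τ, eisGen_eq_thetaQuot τ⟩, fun p hp ↦ ?_, fun τ ↦ ?_,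
    thetaMap, fun τ ↦ ⟨kleinPoint_thetaVec_ne_zero τ, rfl⟩, thetaMap_mem_kleinLocus⟩
  · have h := relations_eisGen 1 τ
    simpa only [relOne, relTwo, mul_one] using h
  · refine ⟨mul_relOne_thetaQuot_one hp, ?_, mul_relTwo_thetaQuot_two hp, relations_iff_rank hp⟩
    rw [kleinMinor_shift]
    exact mul_relTwo_thetaQuot_one hp
  · have hm := kleinMinor_eq_zero_of_rank (rank_kleinMatrix_thetaVec τ)
    have h1 := hm 0 1
    -- The second theta identity is, up to sign, the minor belonging to S_1, which sits at position
    -- (2, 4) before the cyclic shift.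
    have h2 := hm 2 4
    rw [kleinMinor, det_fin_four] at h1 h2
    simp [kleinMatrix, kleinPoint, Fin.succAbove, thetaVec] at h1 h2
    exact ⟨by linear_combination h1, by linear_combination -h2, hm 0 1, hm 0 2⟩
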